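/- Let $\mathbb K=\mathbb R$ or $\mathbb C$, let $\Omega$ be a non-empty set and let $(\mathcal F,\tau)$ be a bornological locally convex Hausdorff space whose underlying vector space $\mathcal F$ is a linear space of $\mathbb K$-valued functions on $\Omega$. Notation. For a locally convex Hausdorff space $Y$, $Y'$ is its topological dual and $Y_b'$ is $Y'$ with the topology of uniform convergence on bounded sets. $\tau_{\mathrm p}$ is the topology of pointwise convergence on $\mathcal F$, and $\delta_x(f):=f(x)$ for $x\in\Omega$, $f\in\mathcal F$. For topologies on $\mathcal F$, $\tau_0\le\tau_1$ means that $\tau_0$ is coarser than $\tau_1$. A space is *completely normable* if its topology is induced by a complete norm. It is *semi-reflexive* if the evaluation map $X\to (X_b')'$ is surjective, and *semi-Montel* if all its bounded sets are relatively compact. For a norm $p$, $B_p$ is its closed unit ball. For a locally convex Hausdorff topology $\widetilde\tau$ on $\mathcal F$ we say that $(\mathcal F,\tau)$ satisfies * (BBC) [resp. (BBCl)] for $\widetilde\tau$ if every $\tau$-bounded set is contained in an absolutely convex $\tau$-bounded $\widetilde\tau$-compact [resp. $\widetilde\tau$-closed] set; * (CNC) for $\widetilde\tau$ if $\tau$ has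 a basis of neighbourhoods of $0$ consisting of absolutely convex $\widetilde\tau$-closed sets. $\mathcal F_{\mathcal B,\widetilde\tau}'$ is the space of all linear functionals on $\mathcal F$ whose restriction to each $\tau$-bounded set is $\widetilde\tau$-continuous. If the $\tau$-bounded sets have a countable basis $(B_n)_{n\in\mathbb N}$ of non-empty absolutely convex $\widetilde\tau$-closed sets with $2B_n\subset B_{n+1}$ for all $n$, the *mixed topology* $\gamma=\gamma(\tau,\widetilde\tau)$ is the locally convex Hausdorff topology that has as a basis of neighbourhoods of $0$ the sets $\bigcup_{n\ge1}\sum_{k=1}^n(U_k\cap B_k)$, where $(U_k)$ runs through the sequences of absolutely convex $\widetilde\tau$-neighbourhoods of $0$; it does not depend on the choice of $(B_n)$. Such $(B_n)$ exist in the situations (c) and (d) below. Then the following assertions are equivalent. (a) $(\mathcal F,\tau)$ admits a strong Banach linearisation: there are a completely normable locally convex Hausdorff space $Y$ over $\mathbb K$, a map $\delta\colon\Omega\to Y$ and a topological isomorphism $T\colon(\mathcal F,\tau)\to Y_b'$ with $T(f)\circ\delta=f$ for all $f\in\mathcal F$. (b) There are a semi-Montel locally convex Hausdorff space $Y$ over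 $\mathbb K$ and a topological isomorphism $\varphi\colon(\mathcal F,\tau)\to(Y_b')_b'$ (a semi-Montel prebidual) such that $Y_b'$ is completely normable and for every $x\in\Omega$ there is a unique $y_x'\in Y'$ with $\delta_x=\varphi(\cdot)(y_x')$. (c) $(\mathcal F,\tau)$ is completely normable and satisfies (BBC) and (CNC) for some locally convex Hausdorff topology $\widetilde\tau$ with $\tau_{\mathrm p}\le\widetilde\tau$ such that $(\mathcal F,\tau)$ and $(\mathcal F,\gamma)$ have the same bounded sets. (d) $(\mathcal F,\tau)$ is completely normable and satisfies (BBCl) for some locally convex Hausdorff topology $\widetilde\tau$ with $\tau_{\mathrm p}\le\widetilde\tau\le\tau$ such that $(\mathcal F,\gamma)$ is semi-reflexive. (e) $(\mathcal F,\tau)$ is completely normable and satisfies (BBC) for some locally convex Hausdorff topology $\widetilde\tau$ with $\tau_{\mathrm p}\le\widetilde\tau$. (f) There are a norm $p$ on $\mathcal F$ which induces $\tau$ and a locally convex Hausdorff topology $\widetilde\tau$ on $\mathcal F$ with $\tau_{\mathrm p}\le\widetilde\tau$ such that $B_p$ is $\widetilde\tau$-compact. (g) There are a norm $p$ on $\mathcal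 F$ which induces $\tau$ and a locally convex Hausdorff topology $\widetilde\tau$ on $\mathcal F$ such that $B_p$ is $\widetilde\tau$-compact and $\delta_x\in\mathcal F_{\mathcal B,\widetilde\tau}'$ for all $x\in\Omega$. (h) $(\mathcal F,\tau)$ is completely normable and satisfies (BBC) for $\tau_{\mathrm p}$. (i) There is a norm $p$ on $\mathcal F$ which induces $\tau$ such that $B_p$ is $\tau_{\mathrm p}$-compact. -/

import Mathlib

open Topology Filter Bornology
open scoped Pointwise ComplexOrder

/-!
Conventions. Several topologies on one vector space `X` are compared, so topologies on `X` are
passed as explicit arguments. In Mathlib's order on topologies `t ≤ s` says that `t` is FINER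
than `s`; hence "`τ₀` is coarser than `τ₁`" is written `τ₁ ≤ τ₀`. The scalar field `𝕜` is `ℝ` or `ℂ`
(`RCLike 𝕜`), absolute convexity is Mathlib's `AbsConvex 𝕜`, and the strong dual `Y'_b` is Mathlib's
`StrongDual 𝕜 Y`, whose topology is that of uniform convergence on bounded sets.
-/

namespace Linearisation

universe u v w w'

section General

variable (𝕜 : Type v) [RCLike 𝕜] {X : Type w} [AddCommGroup X] [Module 𝕜 X]

/-- `τ` is a locally convex Hausdorff (vector space) topology on `X`. -/
structure IsLCH (τ : TopologicalSpace X) : Prop where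
  polynormable : @PolynormableSpace 𝕜 X _ _ _ τ
  t2 : @T2Space X τ

/-- `B` is a bounded subset of `(X, τ)`. -/
def IsBdd (τ : TopologicalSpace X) (B : Set X) : Prop :=
  @IsVonNBounded 𝕜 X _ _ _ τ B

/-- `(X, τ)` is bornological: every absolutely convex set that absorbs all bounded sets is a
neighbourhood of zero. -/
def IsBornologicalSpace (τ : TopologicalSpace X) : Prop :=
  ∀ U : Set X, AbsConvex 𝕜 U → (∀ B : Set X, IsBdd 𝕜 τ B → Absorbs 𝕜 U B) → U ∈ @nhds X τ 0

variable {𝕜} in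
/-- The seminorm `p` is a norm and it induces the topology `τ`. -/
structure IsNormInducing (τ : TopologicalSpace X) (p : Seminorm 𝕜 X) : Prop where
  eq_zero : ∀ x, p x = 0 → x = 0
  induces : @WithSeminorms 𝕜 X Unit _ _ _ (fun _ => p) τ

/-- `(X, τ)` is completely normable: `τ` is induced by a norm for which `X` is complete. -/
def CompletelyNormable (τ : TopologicalSpace X) : Prop :=
  ∃ p : Seminorm 𝕜 X, IsNormInducing τ p ∧
    ∀ s : ℕ → X, (∀ ε > 0, ∃ N, ∀ m ≥ N, ∀ n ≥ N, p (s m - s n) < ε) →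
      ∃ x, Tendsto (fun n => p (s n - x)) atTop (𝓝 0)

/-- Condition (BBC) for `τ'`: every `τ`-bounded set is contained in an absolutely convex
`τ`-bounded `τ'`-compact set. -/
def BBC (τ τ' : TopologicalSpace X) : Prop :=
  ∀ B : Set X, IsBdd 𝕜 τ B →
    ∃ C : Set X, B ⊆ C ∧ AbsConvex 𝕜 C ∧ IsBdd 𝕜 τ C ∧ @IsCompact X τ' C

/-- Condition (BBCl) for `τ'`: every `τ`-bounded set is contained in an absolutely convex
`τ`-bounded `τ'`-closed set. -/
def BBCl (τ τ' : TopologicalSpace X) : Prop :=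
  ∀ B : Set X, IsBdd 𝕜 τ B →
    ∃ C : Set X, B ⊆ C ∧ AbsConvex 𝕜 C ∧ IsBdd 𝕜 τ C ∧ IsClosed[τ'] C

/-- Condition (CNC) for `τ'`: `τ` has a basis of neighbourhoods of zero consisting of absolutely
convex `τ'`-closed sets. -/
def CNC (τ τ' : TopologicalSpace X) : Prop :=
  ∀ U ∈ @nhds X τ 0, ∃ V ∈ @nhds X τ 0, V ⊆ U ∧ AbsConvex 𝕜 V ∧ IsClosed[τ'] V

/-- `(Bₙ)` is a countable basis of the `τ`-bounded sets consisting of (non-empty) absolutely convex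
`τ'`-closed sets with `2 Bₙ ⊆ Bₙ₊₁`. -/
structure IsMixedBasis (τ τ' : TopologicalSpace X) (B : ℕ → Set X) : Prop where
  nonempty : ∀ n, (B n).Nonempty
  absConvex : ∀ n, AbsConvex 𝕜 (B n)
  bdd : ∀ n, IsBdd 𝕜 τ (B n)
  closed : ∀ n, IsClosed[τ'] (B n)
  basis : ∀ C : Set X, IsBdd 𝕜 τ C → ∃ n, C ⊆ B n
  two_smul : ∀ n, (2 : 𝕜) • B n ⊆ B (n + 1)

/-- `(Uₙ)` is a sequence of absolutely convex neighbourhoods of zero in `(X, τ')`. -/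
def IsNhdSeq (τ' : TopologicalSpace X) (U : ℕ → Set X) : Prop :=
  ∀ n, AbsConvex 𝕜 (U n) ∧ U n ∈ @nhds X τ' 0

/-- The set `⋃ₙ ∑_{k ≤ n} (U_k ∩ B_k)`. -/
def mixedSet (U B : ℕ → Set X) : Set X :=
  ⋃ n : ℕ, ∑ k ∈ Finset.range (n + 1), (U k ∩ B k)

theorem mixedSet_mono {U U' B : ℕ → Set X} (h : ∀ k, U k ⊆ U' k) :
    mixedSet U B ⊆ mixedSet U' B :=
  Set.iUnion_mono fun _ => Set.finsetSum_subset_finsetSum _ _ _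
    fun k _ => Set.inter_subset_inter_left _ (h k)

/-- The mixed topology `γ(τ, τ')`, whose neighbourhoods of zero have the sets `mixedSet U B` as a
basis, where `B` is any basis of the `τ`-bounded sets as in `IsMixedBasis` and `U` runs through the
sequences of absolutely convex neighbourhoods of zero of `τ'`. The topology does not depend on the
choice of `B`; it is only used where such a `B` exists (for instance, whenever `τ` is normable and
(BBCl) holds for `τ'`). -/
@[reducible]
def mixedTopology (τ τ' : TopologicalSpace X) : TopologicalSpace X where
  IsOpen s := ∀ B : ℕ → Set X, IsMixedBasis 𝕜 τ τ' B →
    ∀ x ∈ s, ∃ U : ℕ → Set X, IsNhdSeq 𝕜 τ' U ∧ x +ᵥ mixedSet U B ⊆ s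
  isOpen_univ := fun _ _ _ _ =>
    ⟨fun _ => Set.univ, fun _ => ⟨AbsConvex.univ, Filter.univ_mem⟩, Set.subset_univ _⟩
  isOpen_inter := by
    intro s t hs ht B hB x hx
    obtain ⟨U, hU, hUs⟩ := hs B hB x hx.1
    obtain ⟨V, hV, hVt⟩ := ht B hB x hx.2
    refine ⟨fun n => U n ∩ V n, fun n => ⟨(hU n).1.inter (hV n).1,
      Filter.inter_mem (hU n).2 (hV n).2⟩, Set.subset_inter ?_ ?_⟩
    · exact (Set.vadd_set_mono (mixedSet_mono fun k => Set.inter_subset_left)).trans hUs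
    · exact (Set.vadd_set_mono (mixedSet_mono fun k => Set.inter_subset_right)).trans hVt
  isOpen_sUnion := by
    intro S hS B hB x hx
    obtain ⟨s, hsS, hxs⟩ := hx
    obtain ⟨U, hU, hUs⟩ := hS s hsS B hB x hxs
    exact ⟨U, hU, hUs.trans (Set.subset_sUnion_of_mem hsS)⟩

/-- Condition (BτBγ): `(X, τ)` and `(X, γ)` have the same bounded sets. -/
def SameBounded (τ γ : TopologicalSpace X) : Prop :=
  ∀ B : Set X, IsBdd 𝕜 τ B ↔ IsBdd 𝕜 γ B

/-- `(X, γ)` is semi-reflexive: the evaluation map `X → (X'_b)'` is surjective. -/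
def SemiReflexive (γ : TopologicalSpace X) : Prop :=
  letI := γ
  ∀ φ : StrongDual 𝕜 (StrongDual 𝕜 X), ∃ x : X, ∀ f : StrongDual 𝕜 X, φ f = f x

/-- `(X, σ)` is a semi-Montel space: every bounded set is relatively compact. -/
def SemiMontel (σ : TopologicalSpace X) : Prop :=
  ∀ B : Set X, IsBdd 𝕜 σ B → @IsCompact X σ (@closure X σ B)

/-- Membership of a linear functional in `X'_{𝓑,τ'}`: its restriction to each `τ`-bounded set is
`τ'`-continuous. -/
def MemBddDual (τ τ' : TopologicalSpace X) (ℓ : X →ₗ[𝕜] 𝕜) : Prop :=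
  ∀ B : Set X, IsBdd 𝕜 τ B → @ContinuousOn X 𝕜 τ' _ ℓ B

variable {𝕜} in
/-- The linear bijection `T : (X, τ) → Z` is a topological isomorphism. -/
def IsTopIso (τ : TopologicalSpace X) {Z : Type w'} [AddCommMonoid Z] [Module 𝕜 Z]
    [σ : TopologicalSpace Z] (T : X ≃ₗ[𝕜] Z) : Prop :=
  Continuous[τ, σ] T ∧ Continuous[σ, τ] T.symm

end General

section Function

variable {𝕜 : Type v} [RCLike 𝕜] {Ω : Type u} (F : Submodule 𝕜 (Ω → 𝕜))

/-- The topology of pointwise convergence on the function space `F`. -/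
@[reducible]
def pointwiseTopology : TopologicalSpace F :=
  TopologicalSpace.induced (fun f : F => (f : Ω → 𝕜)) Pi.topologicalSpace

/-- The point evaluation `δ_x : F → 𝕜`. -/
def pointEval (x : Ω) : F →ₗ[𝕜] 𝕜 := (LinearMap.proj x).comp F.subtype

/-- `(δ, Y, T)` is a strong linearisation of `(F, τ)`: `T : (F, τ) → Y'_b` is a topological
isomorphism with `T f ∘ δ = f` for all `f`. -/
def IsStrongLinearisation (τ : TopologicalSpace F) {Y : Type w} [AddCommGroup Y] [Module 𝕜 Y]
    [TopologicalSpace Y] (δ : Ω → Y) (T : F ≃ₗ[𝕜] StrongDual 𝕜 Y) : Prop :=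
  IsTopIso τ T ∧ ∀ f : F, (T f : Y → 𝕜) ∘ δ = (f : Ω → 𝕜)

/-- `(F, τ)` admits a strong Banach linearisation: a strong linearisation `(δ, Y, T)` with a
completely normable locally convex Hausdorff space `Y`. -/
def AdmitsStrongBanachLinearisation (τ : TopologicalSpace F) : Prop :=
  ∃ (Y : Type (max u v)) (_ : AddCommGroup Y) (_ : Module 𝕜 Y) (σ : TopologicalSpace Y),
    IsLCH 𝕜 σ ∧ CompletelyNormable 𝕜 σ ∧
      ∃ (δ : Ω → Y) (T : F ≃ₗ[𝕜] StrongDual 𝕜 Y), IsStrongLinearisation F τ δ T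

/-- `(F, τ)` has a semi-Montel prebidual `(Y, φ)`, that is, `φ : (F, τ) → (Y'_b)'_b` is a topological
isomorphism, such that `Y'_b` is completely normable and for every `x` there is a unique `y'` in `Y'`
with `δ_x = φ(·)(y')`. -/
def HasSemiMontelPrebidualWithEvaluations (τ : TopologicalSpace F) : Prop :=
  ∃ (Y : Type (max u v)) (_ : AddCommGroup Y) (_ : Module 𝕜 Y) (σ : TopologicalSpace Y),
    IsLCH 𝕜 σ ∧ SemiMontel 𝕜 σ ∧
      CompletelyNormable 𝕜 (inferInstance : TopologicalSpace (StrongDual 𝕜 Y)) ∧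
      ∃ φ : F ≃ₗ[𝕜] StrongDual 𝕜 (StrongDual 𝕜 Y), IsTopIso τ φ ∧
        ∀ x : Ω, ∃! y' : StrongDual 𝕜 Y, ∀ f : F, pointEval F x f = φ f y'

end Function

end Linearisation

/-! Everything revolves around (i): an equivalent norm `p` whose closed unit ball is compact for
pointwise convergence. A dual Banach space has such a norm by the Alaoglu argument: the linear
functionals dominated by a fixed function form a Tychonoff-compact set, and composing with `δ` keeps
it compact (`isCompact_pointwise_of_linear`). Under the (BBC) conditions, a bounded compact
absolutely convex set that contains a unit ball is itself the closed unit ball of an equivalent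
norm, namely of its gauge (`IsNormInducing.exists_isCompact`). Compactness passes to the pointwise
topology from any topology that makes the point evaluations continuous on bounded sets. In (d),
semi-reflexivity turns the dominated functionals on the strong dual into points of `F`, so the
Alaoglu argument applies again.

Conversely, given (i), the prebidual is `F` with the mixed topology γ of τ and the pointwise
topology. The key is that γ is generated by the seminorms that are pointwise-continuous at zero
along τ-bounded sets (`withSeminorms_mixedTopology`). Hence γ agrees with the pointwise topology on
bounded sets, so the unit ball is γ-compact, and a functional that is γ-continuous on the ball is
γ-continuous, so the strong dual of γ is complete. By Hahn–Banach, γ has no new bounded sets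
(`isBdd_of_mixedTopology`). A Helly-type argument then identifies `F` with the strong bidual of γ
(`exists_isTopIso_bidual`), and the strong dual of γ, with the point evaluations as `δ`, is the
Banach predual required in (a). -/

namespace Linearisation

universe u v w

/-! ### Absolutely convex sets, gauges, Hahn–Banach separation and normed topologies. -/

section Basics

variable {𝕜 : Type v} [RCLike 𝕜] {X : Type w} [AddCommGroup X] [Module 𝕜 X]

theorem AbsConvex.zero_mem {V : Set X} (hV : AbsConvex 𝕜 V) (hne : V.Nonempty) : (0 : X) ∈ V := by
  obtain ⟨x, hx⟩ := hne
  simpa using hV.1.smul_mem (a := (0 : 𝕜)) (by simp) hx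

theorem AbsConvex.smul_set {V : Set X} (hV : AbsConvex 𝕜 V) (c : 𝕜) : AbsConvex 𝕜 (c • V) :=
  ⟨hV.1.smul c, hV.2.smul c⟩

theorem Seminorm.absConvex_closedBall (q : Seminorm 𝕜 X) (r : ℝ) :
    AbsConvex 𝕜 (q.closedBall 0 r) := by
  -- Restriction of scalars supplies the real structure in which convexity of balls is expressed.
  let : Module ℝ X := Module.compHom X (algebraMap ℝ 𝕜)
  have : IsScalarTower ℝ 𝕜 X := ⟨fun a b x => by
    rw [Algebra.smul_def, mul_smul]; rfl⟩
  exact ⟨q.balanced_closedBall_zero r, convex_RCLike_iff_convex_real.2 (q.convex_closedBall 0 r)⟩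

theorem Seminorm.absConvex_ball (q : Seminorm 𝕜 X) (r : ℝ) :
    AbsConvex 𝕜 (q.ball 0 r) := by
  let : Module ℝ X := Module.compHom X (algebraMap ℝ 𝕜)
  have : IsScalarTower ℝ 𝕜 X := ⟨fun a b x => by
    rw [Algebra.smul_def, mul_smul]; rfl⟩
  exact ⟨q.balanced_ball_zero r, convex_RCLike_iff_convex_real.2 (q.convex_ball 0 r)⟩

/-- The Minkowski functional of an absorbing absolutely convex set. -/
theorem exists_seminorm_of_absConvex {V : Set X} (hV : AbsConvex 𝕜 V)
    (habs : ∀ x, ∃ c : 𝕜, c ≠ 0 ∧ c • x ∈ V) :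
    ∃ q : Seminorm 𝕜 X, q.ball 0 1 ⊆ V ∧ V ⊆ q.closedBall 0 1 := by
  let : Module ℝ X := Module.compHom X (algebraMap ℝ 𝕜)
  have : IsScalarTower ℝ 𝕜 X := ⟨fun a b x => by
    rw [Algebra.smul_def, mul_smul]; rfl⟩
  have hconv : Convex ℝ V := convex_RCLike_iff_convex_real.1 hV.2
  have h0 : (0 : X) ∈ V := by
    obtain ⟨c, -, hc⟩ := habs 0
    exact AbsConvex.zero_mem hV ⟨_, hc⟩
  have hA : Absorbent ℝ V := by
    intro x
    obtain ⟨c, hc0, hc⟩ := habs x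
    rw [absorbs_iff_eventually_cobounded_mapsTo]
    filter_upwards [eventually_cobounded_le_norm ‖c‖⁻¹] with r hr
    intro y hy
    rw [Set.mem_singleton_iff.1 hy]
    have hcp : 0 < ‖c‖ := norm_pos_iff.2 hc0
    have hr0 : 0 < ‖r‖ := lt_of_lt_of_le (inv_pos.2 hcp) hr
    -- Write `r⁻¹ • x = (r⁻¹ * c⁻¹) • (c • x)`; the scalar has norm at most `1` because `‖c‖⁻¹ ≤
    -- ‖r‖`, and `V` is balanced.
    have : ((r⁻¹ : ℝ) : 𝕜) • x ∈ V := by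
      have := hV.1.smul_mem (a := ((r⁻¹ : ℝ) : 𝕜) * c⁻¹) ?_ hc
      · rwa [smul_smul, mul_assoc, inv_mul_cancel₀ hc0, mul_one] at this
      · rw [norm_mul, RCLike.norm_ofReal, norm_inv, abs_inv, ← Real.norm_eq_abs]
        rw [inv_mul_le_iff₀ hr0, mul_one]
        exact hr
    exact this
  refine ⟨gaugeSeminorm hV.1 hconv hA, fun x hx => ?_, fun x hx => ?_⟩
  · rw [Seminorm.mem_ball_zero] at hx
    exact setOfPred_gauge_lt_one_subset_self hconv h0 hA hx
  · rw [Seminorm.mem_closedBall_zero]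
    exact gauge_le_one_of_mem hx

section Polynormable

variable [TopologicalSpace X]

theorem PolynormableSpace.isTopologicalAddGroup [PolynormableSpace 𝕜 X] :
    IsTopologicalAddGroup X :=
  (PolynormableSpace.withSeminorms 𝕜 X).topologicalAddGroup

theorem PolynormableSpace.continuousSMul [PolynormableSpace 𝕜 X] : ContinuousSMul 𝕜 X :=
  (PolynormableSpace.withSeminorms 𝕜 X).continuousSMul

theorem PolynormableSpace.exists_ball_subset [PolynormableSpace 𝕜 X] {U : Set X} (hU : U ∈ 𝓝 0) :
    ∃ q : Seminorm 𝕜 X, Continuous q ∧ q.ball 0 1 ⊆ U := by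
  have := PolynormableSpace.isTopologicalAddGroup (𝕜 := 𝕜) (X := X)
  have := PolynormableSpace.continuousSMul (𝕜 := 𝕜) (X := X)
  have hw := PolynormableSpace.withSeminorms 𝕜 X
  obtain ⟨⟨s, r⟩, hr, hs⟩ := hw.hasBasis_zero_ball.mem_iff.1 hU
  dsimp only at hr hs
  set p := s.sup fun p : {p : Seminorm 𝕜 X // Continuous p} => p.1
  refine ⟨(Real.toNNReal r⁻¹) • p, ?_, fun x hx => hs ?_⟩
  · refine Seminorm.continuous (𝕜 := 𝕜) (r := 1)
      (mem_of_superset (hw.hasBasis_zero_ball.mem_of_mem (i := (s, r)) hr) ?_)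
    intro x hx
    rw [Seminorm.mem_ball_zero] at hx ⊢
    rw [smul_apply, NNReal.smul_def, smul_eq_mul, Real.coe_toNNReal _ (by positivity),
      inv_mul_lt_iff₀ hr, mul_one]
    exact hx
  · rw [Seminorm.mem_ball_zero] at hx ⊢
    rw [smul_apply, NNReal.smul_def, smul_eq_mul, Real.coe_toNNReal _ (by positivity),
      inv_mul_lt_iff₀ hr, mul_one] at hx
    exact hx

/-- Separation of a point from a closed absolutely convex set. -/
theorem PolynormableSpace.exists_separating [PolynormableSpace 𝕜 X] {C : Set X}
    (hC : AbsConvex 𝕜 C) (hne : C.Nonempty) (hcl : IsClosed C) {x : X} (hx : x ∉ C) :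
    ∃ ℓ : StrongDual 𝕜 X, (∀ y ∈ C, ‖ℓ y‖ ≤ 1) ∧ 1 < ‖ℓ x‖ := by
  have := PolynormableSpace.isTopologicalAddGroup (𝕜 := 𝕜) (X := X)
  have := PolynormableSpace.continuousSMul (𝕜 := 𝕜) (X := X)
  let : Module ℝ X := Module.compHom X (algebraMap ℝ 𝕜)
  have : IsScalarTower ℝ 𝕜 X := ⟨fun a b x => by
    rw [Algebra.smul_def, mul_smul]; rfl⟩
  have : LocallyConvexSpace ℝ X := (PolynormableSpace.withSeminorms 𝕜 X).toLocallyConvexSpace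
  obtain ⟨ℓ, s, h1, h2⟩ := RCLike.geometric_hahn_banach_closed_point (𝕜 := 𝕜)
    (convex_RCLike_iff_convex_real.1 hC.2) hcl hx
  have h3 : ∀ y ∈ C, ‖ℓ y‖ ≤ s := by
    intro y hy
    by_cases h0 : ℓ y = 0
    · rw [h0, norm_zero]
      have := h1 _ hy
      rw [h0, map_zero] at this
      exact this.le
    have hn : (‖ℓ y‖ : 𝕜) ≠ 0 := by simpa using h0
    -- Multiplying `y` by a scalar of modulus one makes `ℓ y` equal to `‖ℓ y‖`, so the bound on the
    -- real part bounds the norm.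
    have := h1 _ (hC.1.smul_mem (a := (‖ℓ y‖ : 𝕜) / ℓ y) (by
      rw [norm_div, RCLike.norm_ofReal, abs_norm, div_self]; simpa using h0) hy)
    rw [map_smul, smul_eq_mul, div_mul_cancel₀ _ h0, RCLike.ofReal_re] at this
    exact this.le
  obtain ⟨y, hy⟩ := hne
  have h4 : 0 ≤ s := (norm_nonneg _).trans (h3 y hy)
  have h5 : s < ‖ℓ x‖ := h2.trans_le (RCLike.re_le_norm _)
  -- Normalising by `r` rather than by `s` covers the case `s = 0`.
  obtain ⟨r, hr, hr'⟩ := exists_between h5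
  have hr0 : 0 < r := h4.trans_lt hr
  refine ⟨((r⁻¹ : ℝ) : 𝕜) • ℓ, fun y hy => ?_, ?_⟩
  · rw [smul_apply, norm_smul, RCLike.norm_ofReal, abs_of_pos (inv_pos.2 hr0),
      inv_mul_le_iff₀ hr0, mul_one]
    exact (h3 y hy).trans hr.le
  · rw [smul_apply, norm_smul, RCLike.norm_ofReal, abs_of_pos (inv_pos.2 hr0),
      lt_inv_mul_iff₀ hr0, mul_one]
    exact hr'

end Polynormable

section NormInducing

variable {τ : TopologicalSpace X} {p : Seminorm 𝕜 X}

theorem IsNormInducing.isBdd_iff (hp : IsNormInducing τ p) {B : Set X} :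
    IsBdd 𝕜 τ B ↔ ∃ r > 0, ∀ x ∈ B, p x ≤ r := by
  let := τ
  refine (hp.induces.isVonNBounded_iff_seminorm_bounded (s := B)).trans ?_
  constructor
  · intro h
    obtain ⟨r, hr, h⟩ := h ()
    exact ⟨r, hr, fun x hx => (h x hx).le⟩
  · rintro ⟨r, hr, h⟩ -
    exact ⟨r + 1, by linarith, fun x hx => by linarith [h x hx]⟩

theorem IsNormInducing.isBdd_closedBall (hp : IsNormInducing τ p) (r : ℝ) :
    IsBdd 𝕜 τ (p.closedBall 0 r) :=
  hp.isBdd_iff.2 ⟨max r 1, lt_max_of_lt_right one_pos, fun x hx => by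
    rw [Seminorm.mem_closedBall_zero] at hx
    exact hx.trans (le_max_left _ _)⟩

theorem IsNormInducing.mem_nhds_zero_iff (hp : IsNormInducing τ p) {U : Set X} :
    U ∈ @nhds X τ 0 ↔ ∃ r > 0, p.ball 0 r ⊆ U := by
  let := τ
  rw [hp.induces.hasBasis_zero_ball.mem_iff]
  constructor
  · rintro ⟨⟨s, r⟩, hr, h⟩
    refine ⟨r, hr, fun x hx => h ?_⟩
    rw [Seminorm.mem_ball_zero] at hx ⊢
    exact Seminorm.finset_sup_apply_lt hr fun _ _ => hx
  · rintro ⟨r, hr, h⟩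
    exact ⟨({()}, r), hr, by simpa using h⟩

theorem IsNormInducing.isLCH (hp : IsNormInducing τ p) : IsLCH 𝕜 τ := by
  let := τ
  have := hp.induces.topologicalAddGroup
  have := hp.induces.T1_of_separating fun x hx => ⟨(), fun h => hx (hp.eq_zero x h)⟩
  exact ⟨hp.induces.toPolynormableSpace, inferInstance⟩

/-- A seminorm equivalent to a norm inducing `τ` induces `τ` as well. -/
theorem IsNormInducing.congr (hp : IsNormInducing τ p) {q : Seminorm 𝕜 X} {a b : ℝ}
    (hpq : ∀ x, p x ≤ a * q x) (hqp : ∀ x, q x ≤ b * p x) : IsNormInducing τ q := by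
  let := τ
  refine ⟨fun x hx => hp.eq_zero x (le_antisymm ?_ (apply_nonneg p x)), ?_⟩
  · simpa [hx] using hpq x
  · refine hp.induces.congr ?_ ?_
    · intro i
      refine ⟨{()}, Real.toNNReal b, fun x => ?_⟩
      simp only [Seminorm.comp_id, Finset.sup_singleton, smul_apply, NNReal.smul_def,
        smul_eq_mul]
      exact (hqp x).trans (mul_le_mul_of_nonneg_right (Real.le_coe_toNNReal b) (apply_nonneg p x))
    · intro i
      refine ⟨{()}, Real.toNNReal a, fun x => ?_⟩
      simp only [Seminorm.comp_id, Finset.sup_singleton, smul_apply, NNReal.smul_def,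
        smul_eq_mul]
      exact (hpq x).trans (mul_le_mul_of_nonneg_right (Real.le_coe_toNNReal a) (apply_nonneg q x))

end NormInducing

end Basics

/-! ### The mixed topology described by seminorms. -/

section Mixed

variable {𝕜 : Type v} [RCLike 𝕜] {X : Type w} [AddCommGroup X] [Module 𝕜 X]

variable (𝕜) in
/-- The seminorms that are `τ'`-continuous at zero along every `τ`-bounded set. -/
def mixedSeminorms (τ τ' : TopologicalSpace X) : Set (Seminorm 𝕜 X) :=
  {q | ∀ C : Set X, IsBdd 𝕜 τ C → ∀ ε > 0, ∀ᶠ x in @nhds X τ' 0, x ∈ C → q x < ε}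

section Closure

variable {τ τ' : TopologicalSpace X} {q q' : Seminorm 𝕜 X}

theorem mixedSeminorms.of_le (hq : q ∈ mixedSeminorms 𝕜 τ τ') {c : ℝ} (hc : 0 < c)
    (h : ∀ x, q' x ≤ c * q x) : q' ∈ mixedSeminorms 𝕜 τ τ' := by
  intro C hC ε hε
  filter_upwards [hq C hC (ε / c) (by positivity)] with x hx hxC
  have := hx hxC
  rw [lt_div_iff₀' hc] at this
  exact (h x).trans_lt this

theorem mixedSeminorms.finset_sup (s : Finset (mixedSeminorms 𝕜 τ τ')) :
    (s.sup fun q => (q : Seminorm 𝕜 X)) ∈ mixedSeminorms 𝕜 τ τ' := by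
  intro C hC ε hε
  filter_upwards [(Finset.eventually_all s).2 fun q _ => q.2 C hC ε hε] with x hx hxC
  exact Seminorm.finset_sup_apply_lt hε fun q hq => hx q hq hxC

theorem mixedSeminorms.of_continuous (hq : @Continuous X ℝ τ' _ q) :
    q ∈ mixedSeminorms 𝕜 τ τ' := by
  let := τ'
  intro C _ ε hε
  have : Tendsto q (𝓝 0) (𝓝 0) := by simpa using hq.tendsto 0
  filter_upwards [this.eventually_lt_const hε] with x hx _ using hx

end Closure

section MixedSet

variable {U B : ℕ → Set X}

theorem mem_mixedSet (h0 : ∀ k, (0 : X) ∈ U k ∩ B k) {n : ℕ} {x : X} (hx : x ∈ U n ∩ B n) :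
    x ∈ mixedSet U B := by
  refine Set.mem_iUnion.2 ⟨n, (Set.mem_finsetSum _ _ _).2 ⟨Pi.single n x, fun {k} _ => ?_, ?_⟩⟩
  · by_cases h : k = n
    · subst h; simpa using hx
    · simpa [h] using h0 k
  · rw [Finset.sum_pi_single']
    simp

theorem absConvex_mixedSet (hU : ∀ n, AbsConvex 𝕜 (U n)) (hB : ∀ n, AbsConvex 𝕜 (B n))
    (h0 : ∀ k, (0 : X) ∈ U k ∩ B k) : AbsConvex 𝕜 (mixedSet U B) := by
  have hsum : ∀ n, AbsConvex 𝕜 (∑ k ∈ Finset.range n, (U k ∩ B k)) := by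
    intro n
    induction n with
    | zero =>
      rw [Finset.sum_range_zero]
      exact ⟨balanced_zero, convex_zero⟩
    | succ n ih =>
      rw [Finset.sum_range_succ]
      exact ⟨ih.1.add ((hU n).inter (hB n)).1, ih.2.add ((hU n).inter (hB n)).2⟩
  refine ⟨balanced_iUnion fun n => (hsum (n + 1)).1, Directed.convex_iUnion
    (Monotone.directed_le (monotone_nat_of_le_succ fun n => ?_)) fun n => (hsum (n + 1)).2⟩
  intro x hx
  rw [Finset.sum_range_succ]
  exact Set.mem_add.2 ⟨x, hx, 0, h0 _, add_zero x⟩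

end MixedSet

variable {τ τ' : TopologicalSpace X}

theorem IsMixedBasis.zero_mem {B : ℕ → Set X} (hB : IsMixedBasis 𝕜 τ τ' B) (n : ℕ) :
    (0 : X) ∈ B n :=
  AbsConvex.zero_mem (hB.absConvex n) (hB.nonempty n)

/-- This is where `2 Bₙ ⊆ Bₙ₊₁` enters: dilating by `2 ^ j` costs only `j` indices, which later
turns a bound `q ≤ 1` into `q ≤ 2 ^ (-j)`. -/
theorem IsMixedBasis.pow_two_smul_mem {B : ℕ → Set X} (hB : IsMixedBasis 𝕜 τ τ' B) (n j : ℕ)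
    {x : X} (hx : x ∈ B n) : (2 ^ j : 𝕜) • x ∈ B (n + j) := by
  induction j with
  | zero => simpa using hx
  | succ j ih =>
    rw [pow_succ', mul_smul]
    exact hB.two_smul _ (Set.smul_mem_smul_set ih)

/-- Seminorms that are `τ'`-continuous along `τ`-bounded sets have unit balls which are mixed
neighbourhoods of zero. -/
theorem exists_mixedSet_subset_ball (hτ' : IsLCH 𝕜 τ') {B : ℕ → Set X}
    (hB : IsMixedBasis 𝕜 τ τ' B) {q : Seminorm 𝕜 X} (hq : q ∈ mixedSeminorms 𝕜 τ τ') :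
    ∃ U, IsNhdSeq 𝕜 τ' U ∧ mixedSet U B ⊆ q.ball 0 1 := by
  let := τ'
  have := hτ'.polynormable
  -- The bounds `2 ^ (-(k + 1))` have all partial sums below `1`, so subadditivity keeps every
  -- finite sum in the unit ball.
  have key : ∀ k : ℕ, ∃ V : Set X, (AbsConvex 𝕜 V ∧ V ∈ 𝓝 0) ∧
      ∀ x ∈ V ∩ B k, q x < (1 / 2) ^ (k + 1) := by
    intro k
    obtain ⟨s, hs, hsub⟩ := PolynormableSpace.exists_ball_subset (𝕜 := 𝕜)
      (hq (B k) (hB.bdd k) ((1 / 2) ^ (k + 1)) (by positivity))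
    exact ⟨s.ball 0 1, ⟨Seminorm.absConvex_ball s 1, s.ball_mem_nhds hs one_pos⟩,
      fun x hx => hsub hx.1 hx.2⟩
  choose U hU hUq using key
  refine ⟨U, hU, ?_⟩
  intro x hx
  obtain ⟨n, hn⟩ := Set.mem_iUnion.1 hx
  obtain ⟨g, hg, rfl⟩ := (Set.mem_finsetSum _ _ _).1 hn
  rw [Seminorm.mem_ball_zero]
  have hgeom : ∀ m : ℕ, ∑ k ∈ Finset.range m, ((1 : ℝ) / 2) ^ (k + 1) = 1 - (1 / 2) ^ m := by
    intro m
    induction m with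
    | zero => simp
    | succ m ih => rw [Finset.sum_range_succ, ih]; ring
  calc q (∑ k ∈ Finset.range (n + 1), g k) ≤ ∑ k ∈ Finset.range (n + 1), q (g k) :=
        Finset.le_sum_of_subadditive q (map_zero q).le (map_add_le_add q) _ _
    _ ≤ ∑ k ∈ Finset.range (n + 1), ((1 : ℝ) / 2) ^ (k + 1) :=
        Finset.sum_le_sum fun k hk => (hUq k _ (hg hk)).le
    _ < 1 := by
        rw [hgeom]
        have : (0 : ℝ) < (1 / 2) ^ (n + 1) := by positivity
        linarith

theorem eventually_smul_mem (hτ' : IsLCH 𝕜 τ') {U : Set X} (hU : U ∈ @nhds X τ' 0) (c : 𝕜) :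
    ∀ᶠ x in @nhds X τ' 0, c • x ∈ U := by
  let := τ'
  have := hτ'.polynormable
  have := PolynormableSpace.continuousSMul (𝕜 := 𝕜) (X := X)
  have h : Tendsto (fun x : X => c • x) (𝓝 0) (𝓝 0) := by
    simpa using (continuous_const_smul c).tendsto (0 : X)
  exact h hU

theorem exists_smul_mem (hτ' : IsLCH 𝕜 τ') {U : Set X} (hU : U ∈ @nhds X τ' 0) (x : X) :
    ∃ c : 𝕜, c ≠ 0 ∧ ‖c‖ ≤ 1 ∧ c • x ∈ U := by
  let := τ'
  have := hτ'.polynormable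
  have := PolynormableSpace.continuousSMul (𝕜 := 𝕜) (X := X)
  have h : Tendsto (fun c : 𝕜 => c • x) (𝓝[≠] 0) (𝓝 0) := by
    have : Tendsto (fun c : 𝕜 => c • x) (𝓝 0) (𝓝 0) := by
      have hc : Continuous fun c : 𝕜 => c • x := continuous_id.smul continuous_const
      simpa using hc.tendsto 0
    exact this.mono_left nhdsWithin_le_nhds
  have h1 : ∀ᶠ c : 𝕜 in 𝓝[≠] 0, ‖c‖ ≤ 1 := by
    have := (continuous_norm (E := 𝕜)).tendsto 0
    rw [norm_zero] at this
    filter_upwards [nhdsWithin_le_nhds (this.eventually_lt_const one_pos)] with c hc using hc.le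
  obtain ⟨c, h2, h3, h4⟩ := ((h.eventually hU).and (h1.and self_mem_nhdsWithin)).exists
  exact ⟨c, h4, h3, h2⟩

theorem isBdd_singleton (hτ : IsLCH 𝕜 τ) (x : X) : IsBdd 𝕜 τ {x} := by
  let := τ
  have := hτ.polynormable
  have := PolynormableSpace.continuousSMul (𝕜 := 𝕜) (X := X)
  exact isVonNBounded_singleton x

/-- Every set `mixedSet U B` contains the unit ball of a seminorm that is `τ'`-continuous along
`τ`-bounded sets. -/
theorem exists_ball_subset_mixedSet (hτ : IsLCH 𝕜 τ) (hτ' : IsLCH 𝕜 τ') {U B : ℕ → Set X}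
    (hB : IsMixedBasis 𝕜 τ τ' B) (hU : IsNhdSeq 𝕜 τ' U) :
    ∃ q ∈ mixedSeminorms 𝕜 τ τ', q.ball 0 1 ⊆ mixedSet U B := by
  have h0 : ∀ k, (0 : X) ∈ U k ∩ B k :=
    fun k => ⟨@mem_of_mem_nhds X τ' _ _ (hU k).2, hB.zero_mem k⟩
  -- `q` is the gauge of the mixed set, which absorbs each `x`: some `Bₙ` contains `x`, and `Uₙ`
  -- contains a small multiple of it.
  obtain ⟨q, hq1, hq2⟩ := exists_seminorm_of_absConvex
    (absConvex_mixedSet (fun n => (hU n).1) hB.absConvex h0) (fun x => by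
      obtain ⟨n, hn⟩ := hB.basis _ (isBdd_singleton hτ x)
      obtain ⟨c, hc0, hc1, hc⟩ := exists_smul_mem hτ' (hU n).2 x
      exact ⟨c, hc0, mem_mixedSet h0 ⟨hc, (hB.absConvex n).1.smul_mem hc1 (hn rfl)⟩⟩)
  refine ⟨q, fun C hC ε hε => ?_, hq1⟩
  obtain ⟨n, hn⟩ := hB.basis C hC
  obtain ⟨j, hj⟩ := pow_unbounded_of_one_lt ε⁻¹ (one_lt_two : (1 : ℝ) < 2)
  -- For `x ∈ C` near zero, `2 ^ j • x` lies in the piece of index `n + j`, where `q ≤ 1`; hence `q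
  -- x ≤ 2 ^ (-j) < ε`.
  filter_upwards [eventually_smul_mem hτ' (hU (n + j)).2 (2 ^ j : 𝕜)] with x hx hxC
  have := hq2 (mem_mixedSet h0 ⟨hx, hB.pow_two_smul_mem n j (hn hxC)⟩)
  rw [Seminorm.mem_closedBall_zero, map_smul_eq_mul, norm_pow, RCLike.norm_two] at this
  have h2 : ε⁻¹ * ε = 1 := inv_mul_cancel₀ hε.ne'
  by_contra! hcon
  have h3 : ε⁻¹ * ε < 2 ^ j * q x :=
    (mul_lt_mul_of_pos_right hj hε).trans_le (by gcongr)
  linarith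

/-- The mixed topology is generated by the seminorms that are `τ'`-continuous along `τ`-bounded
sets. -/
theorem withSeminorms_mixedTopology (hτ : IsLCH 𝕜 τ) (hτ' : IsLCH 𝕜 τ')
    (hB : ∃ B, IsMixedBasis 𝕜 τ τ' B) :
    @WithSeminorms 𝕜 X _ _ _ _ (fun q : mixedSeminorms 𝕜 τ τ' => (q : Seminorm 𝕜 X))
      (mixedTopology 𝕜 τ τ') := by
  set P : SeminormFamily 𝕜 X (mixedSeminorms 𝕜 τ τ') := fun q => (q : Seminorm 𝕜 X) with hP
  let σ : TopologicalSpace X := P.moduleFilterBasis.topology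
  have hw : @WithSeminorms 𝕜 X _ _ _ _ P σ := @WithSeminorms.mk _ _ _ _ _ _ P σ rfl
  -- The mixed topology is given by its open sets only, so these are compared directly. A basis `B`
  -- must exist: otherwise the quantifier over `B` is vacuous and every set is open.
  suffices h : mixedTopology 𝕜 τ τ' = σ by rw [h]; exact hw
  refine TopologicalSpace.ext_iff.2 fun s => ?_
  have hσ : IsOpen[σ] s ↔ ∀ x ∈ s, ∃ q ∈ mixedSeminorms 𝕜 τ τ', x +ᵥ q.ball 0 1 ⊆ s := by
    rw [hw.isOpen_iff_mem_balls]
    refine forall₂_congr fun x hx => ⟨?_, ?_⟩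
    · rintro ⟨t, r, hr, h⟩
      -- The family is closed under finite suprema and positive multiples, so one unit ball replaces
      -- a finite intersection of balls.
      refine ⟨Real.toNNReal r⁻¹ • t.sup P, mixedSeminorms.of_le (mixedSeminorms.finset_sup t)
        (inv_pos.2 hr) fun y => ?_, ?_⟩
      · rw [smul_apply, NNReal.smul_def, smul_eq_mul, Real.coe_toNNReal _ (by positivity)]
      · rw [Seminorm.vadd_ball, vadd_eq_add, add_zero]
        intro y hy
        refine h ?_
        rw [Seminorm.mem_ball] at hy ⊢
        rw [smul_apply, NNReal.smul_def, smul_eq_mul, Real.coe_toNNReal _ (by positivity),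
          inv_mul_lt_iff₀ hr, mul_one] at hy
        exact hy
    · rintro ⟨q, hq, h⟩
      refine ⟨{⟨q, hq⟩}, 1, one_pos, ?_⟩
      rw [Seminorm.vadd_ball, vadd_eq_add, add_zero] at h
      simpa [hP] using h
  rw [hσ]
  constructor
  · intro h x hx
    obtain ⟨B, hB⟩ := hB
    obtain ⟨U, hU, hs⟩ := h B hB x hx
    obtain ⟨q, hq, hqs⟩ := exists_ball_subset_mixedSet hτ hτ' hB hU
    exact ⟨q, hq, (Set.vadd_set_mono hqs).trans hs⟩
  · intro h B hB x hx
    obtain ⟨q, hq, hs⟩ := h x hx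
    obtain ⟨U, hU, hUq⟩ := exists_mixedSet_subset_ball hτ' hB hq
    exact ⟨U, hU, (Set.vadd_set_mono hUq).trans hs⟩

theorem mixedTopology_le (hτ : IsLCH 𝕜 τ) (hτ' : IsLCH 𝕜 τ')
    (hB : ∃ B, IsMixedBasis 𝕜 τ τ' B) : mixedTopology 𝕜 τ τ' ≤ τ' := by
  have hw := withSeminorms_mixedTopology hτ hτ' hB
  rw [← continuous_id_iff_le]
  have hw' := @PolynormableSpace.withSeminorms 𝕜 X _ _ _ τ' hτ'.polynormable
  let γ := mixedTopology 𝕜 τ τ'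
  have := hw.topologicalAddGroup
  exact @WithSeminorms.continuous_of_continuous_comp 𝕜 𝕜 X X _ _ _ _ _ _ _ (RingHom.id 𝕜) _ _ γ
    inferInstance τ' hw' LinearMap.id
    fun q => hw.continuous_seminorm ⟨q.1, mixedSeminorms.of_continuous q.2⟩

theorem isLCH_mixedTopology (hτ : IsLCH 𝕜 τ) (hτ' : IsLCH 𝕜 τ')
    (hB : ∃ B, IsMixedBasis 𝕜 τ τ' B) : IsLCH 𝕜 (mixedTopology 𝕜 τ τ') := by
  refine ⟨@WithSeminorms.toPolynormableSpace _ _ _ _ _ _ (mixedTopology 𝕜 τ τ') _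
    (withSeminorms_mixedTopology hτ hτ' hB), ?_⟩
  exact @T2Space.of_injective_continuous X X (mixedTopology 𝕜 τ τ') τ' hτ'.t2 id Function.injective_id
    (continuous_id_iff_le.2 (mixedTopology_le hτ hτ' hB))

/-- A linear functional is continuous for the mixed topology if and only if its absolute value is
`τ'`-continuous at zero along `τ`-bounded sets. -/
theorem continuous_mixedTopology_iff (hτ : IsLCH 𝕜 τ) (hτ' : IsLCH 𝕜 τ')
    (hB : ∃ B, IsMixedBasis 𝕜 τ τ' B) (ℓ : X →ₗ[𝕜] 𝕜) :
    @Continuous X 𝕜 (mixedTopology 𝕜 τ τ') _ ℓ ↔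
      (normSeminorm 𝕜 𝕜).comp ℓ ∈ mixedSeminorms 𝕜 τ τ' := by
  have hw := withSeminorms_mixedTopology hτ hτ' hB
  let γ := mixedTopology 𝕜 τ τ'
  have := hw.topologicalAddGroup
  constructor
  · intro h
    have hc : Continuous ((normSeminorm 𝕜 𝕜).comp ℓ) := continuous_norm.comp h
    obtain ⟨s, C, hC0, hC⟩ := Seminorm.bound_of_continuous hw _ hc
    exact mixedSeminorms.of_le (mixedSeminorms.finset_sup s) (c := C)
      (lt_of_le_of_ne C.2 fun h => hC0 (NNReal.coe_eq_zero.1 h.symm)) hC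
  · intro h
    have hc : Continuous ((normSeminorm 𝕜 𝕜).comp ℓ) := hw.continuous_seminorm ⟨_, h⟩
    refine continuous_of_continuousAt_zero ℓ ?_
    rw [ContinuousAt, map_zero, tendsto_zero_iff_norm_tendsto_zero]
    have := hc.tendsto 0
    rwa [map_zero] at this

end Mixed

/-! ### Compact or closed unit balls and the mixed topology of a norm topology. -/

section MixedNormed

variable {𝕜 : Type v} [RCLike 𝕜] {X : Type w} [AddCommGroup X] [Module 𝕜 X]
  {τ τ' : TopologicalSpace X} {p : Seminorm 𝕜 X}

theorem norm_ofReal_inv {r : ℝ} (hr : 0 < r) : ‖((r⁻¹ : ℝ) : 𝕜)‖ = r⁻¹ := by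
  rw [RCLike.norm_ofReal, abs_of_pos (inv_pos.2 hr)]

theorem ofReal_inv_smul_smul {r : ℝ} (hr : 0 < r) (x : X) :
    (r : 𝕜) • ((r⁻¹ : ℝ) : 𝕜) • x = x := by
  rw [smul_smul, ← RCLike.ofReal_mul, mul_inv_cancel₀ hr.ne', RCLike.ofReal_one, one_smul]

theorem inv_smul_mem_closedBall (p : Seminorm 𝕜 X) {r : ℝ} (hr : 0 < r) {x : X} (hx : p x ≤ r) :
    ((r⁻¹ : ℝ) : 𝕜) • x ∈ p.closedBall 0 1 := by
  rw [Seminorm.mem_closedBall_zero, map_smul_eq_mul, norm_ofReal_inv hr, inv_mul_le_iff₀ hr,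
    mul_one]
  exact hx

theorem Seminorm.le_mul_of_closedBall (h0 : ∀ x, p x = 0 → x = 0) {q : Seminorm 𝕜 X} {M : ℝ}
    (h : ∀ x ∈ p.closedBall 0 1, q x ≤ M) (x : X) : q x ≤ M * p x := by
  rcases (apply_nonneg p x).eq_or_lt with hx | hx
  · rw [h0 x hx.symm]; simp
  have h1 := h _ (inv_smul_mem_closedBall p hx le_rfl)
  rw [map_smul_eq_mul, norm_ofReal_inv hx, inv_mul_le_iff₀ hx] at h1
  linarith

theorem isCompact_closedBall_of_one [TopologicalSpace X] [ContinuousSMul 𝕜 X]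
    (hK : IsCompact (p.closedBall 0 1)) {r : ℝ} (hr : 0 < r) : IsCompact (p.closedBall 0 r) := by
  have : p.closedBall 0 r = (r : 𝕜) • p.closedBall 0 1 := by
    ext x
    constructor
    · intro hx
      exact ⟨_, inv_smul_mem_closedBall p hr (by simpa using hx), ofReal_inv_smul_smul hr x⟩
    · rintro ⟨y, hy, rfl⟩
      rw [Seminorm.mem_closedBall_zero] at hy ⊢
      change p ((r : 𝕜) • y) ≤ r
      rw [map_smul_eq_mul, RCLike.norm_ofReal, abs_of_pos hr]
      exact mul_le_of_le_one_right hr.le hy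
  rw [this]
  exact hK.smul _

theorem IsLCH.isCompact_closedBall (hτ' : IsLCH 𝕜 τ') (hK : @IsCompact X τ' (p.closedBall 0 1))
    {r : ℝ} (hr : 0 < r) : @IsCompact X τ' (p.closedBall 0 r) := by
  have := hτ'.polynormable
  have := PolynormableSpace.continuousSMul (𝕜 := 𝕜) (X := X)
  exact isCompact_closedBall_of_one hK hr

theorem IsLCH.isClosed_closedBall (hτ' : IsLCH 𝕜 τ') (hK : @IsCompact X τ' (p.closedBall 0 1))
    {r : ℝ} (hr : 0 < r) : IsClosed[τ'] (p.closedBall 0 r) :=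
  @IsCompact.isClosed X τ' hτ'.t2 _ (hτ'.isCompact_closedBall hK hr)

theorem isCompact_of_le {Z : Type*} {t t' : TopologicalSpace Z} (hle : t ≤ t') {C : Set Z}
    (hC : @IsCompact Z t C) : @IsCompact Z t' C := by
  have := @IsCompact.image Z Z t t' C id hC (continuous_id_iff_le.2 hle)
  rwa [Set.image_id] at this

theorem IsNormInducing.continuous_functional (hp : IsNormInducing τ p) (L : X →ₗ[𝕜] 𝕜) {M : ℝ}
    (h : ∀ x, ‖L x‖ ≤ M * p x) : @Continuous X 𝕜 τ _ L := by
  let := τ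
  have := hp.induces.topologicalAddGroup
  refine continuous_of_continuousAt_zero L ?_
  rw [ContinuousAt, map_zero]
  refine Metric.nhds_basis_ball.tendsto_right_iff.2 fun ε hε => ?_
  have hM : 0 < |M| + 1 := by positivity
  filter_upwards [hp.mem_nhds_zero_iff.2 ⟨ε / (|M| + 1), by positivity, Set.Subset.rfl⟩] with z hz
  rw [Seminorm.mem_ball_zero, lt_div_iff₀ hM] at hz
  rw [mem_ball_zero_iff]
  refine (h z).trans_lt (lt_of_le_of_lt ?_ hz)
  rw [mul_comm]
  exact mul_le_mul_of_nonneg_left (by linarith [le_abs_self M]) (apply_nonneg p z)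

/-- A norm with compact unit ball for a coarser Hausdorff topology is complete. -/
theorem completelyNormable_of_isCompact (hp : IsNormInducing τ p) (hτ' : IsLCH 𝕜 τ')
    (hK : @IsCompact X τ' (p.closedBall 0 1)) : CompletelyNormable 𝕜 τ := by
  refine ⟨p, hp, fun s hs => ?_⟩
  let := τ'
  have := hτ'.polynormable
  have := PolynormableSpace.isTopologicalAddGroup (𝕜 := 𝕜) (X := X)
  obtain ⟨N, hN⟩ := hs 1 one_pos
  have hR : 0 < p (s N) + 1 := by linarith [apply_nonneg p (s N)]
  -- A Cauchy sequence is eventually in a `τ'`-compact ball and so has a `τ'`-cluster point. As the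
  -- balls are `τ'`-closed, the Cauchy estimate survives in this limit.
  obtain ⟨x, -, hx⟩ := (hτ'.isCompact_closedBall hK hR).exists_clusterPt (f := map s atTop) (by
    rw [le_principal_iff, mem_map]
    filter_upwards [eventually_ge_atTop N] with n hn
    rw [Set.mem_preimage, Seminorm.mem_closedBall_zero]
    calc p (s n) = p (s N + (s n - s N)) := by rw [add_sub_cancel]
      _ ≤ p (s N) + p (s n - s N) := map_add_le_add p _ _
      _ ≤ p (s N) + 1 := by linarith [hN n hn N le_rfl])
  refine ⟨x, Metric.tendsto_atTop.2 fun ε hε => ?_⟩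
  obtain ⟨N, hN⟩ := hs (ε / 2) (half_pos hε)
  refine ⟨N, fun n hn => ?_⟩
  have hcl : IsClosed ((fun y => s n - y) ⁻¹' p.closedBall 0 (ε / 2)) :=
    (hτ'.isClosed_closedBall hK (half_pos hε)).preimage (continuous_const.sub continuous_id)
  have hmem : x ∈ ((fun y => s n - y) ⁻¹' p.closedBall 0 (ε / 2)) := by
    refine isClosed_iff_clusterPt.1 hcl x (hx.mono ?_)
    rw [le_principal_iff, mem_map]
    filter_upwards [eventually_ge_atTop N] with m hm
    rw [Set.mem_preimage]
    rw [Set.mem_preimage, Seminorm.mem_closedBall_zero]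
    exact (hN n hn m hm).le
  rw [Set.mem_preimage, Seminorm.mem_closedBall_zero] at hmem
  rw [Real.dist_0_eq_abs, abs_of_nonneg (apply_nonneg _ _)]
  linarith

theorem bbc_of_isCompact (hp : IsNormInducing τ p) (hτ' : IsLCH 𝕜 τ')
    (hK : @IsCompact X τ' (p.closedBall 0 1)) : BBC 𝕜 τ τ' := by
  intro B hB
  obtain ⟨r, hr, hBr⟩ := hp.isBdd_iff.1 hB
  exact ⟨p.closedBall 0 r, fun x hx => by simpa using hBr x hx, Seminorm.absConvex_closedBall p r,
    hp.isBdd_closedBall r, hτ'.isCompact_closedBall hK hr⟩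

theorem BBC.bbcl (hτ' : IsLCH 𝕜 τ') (h : BBC 𝕜 τ τ') : BBCl 𝕜 τ τ' := by
  intro B hB
  obtain ⟨C, h1, h2, h3, h4⟩ := h B hB
  exact ⟨C, h1, h2, h3, @IsCompact.isClosed X τ' hτ'.t2 _ h4⟩

theorem cnc_of_isCompact (hp : IsNormInducing τ p) (hτ' : IsLCH 𝕜 τ')
    (hK : @IsCompact X τ' (p.closedBall 0 1)) : CNC 𝕜 τ τ' := by
  intro U hU
  obtain ⟨r, hr, hrU⟩ := hp.mem_nhds_zero_iff.1 hU
  refine ⟨p.closedBall 0 (r / 2), hp.mem_nhds_zero_iff.2 ⟨r / 2, half_pos hr, fun x hx => ?_⟩,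
    fun x hx => hrU ?_, Seminorm.absConvex_closedBall p _,
    hτ'.isClosed_closedBall hK (half_pos hr)⟩
  · rw [Seminorm.mem_ball_zero] at hx
    rw [Seminorm.mem_closedBall_zero]
    exact hx.le
  · rw [Seminorm.mem_closedBall_zero] at hx
    rw [Seminorm.mem_ball_zero]
    linarith

/-- A norm with compact unit ball from a bounded compact absolutely convex set
containing the unit ball of a norm. -/
theorem IsNormInducing.exists_isCompact (hp : IsNormInducing τ p) (hτ' : IsLCH 𝕜 τ') {C : Set X}
    (hC : AbsConvex 𝕜 C) (hb : IsBdd 𝕜 τ C) (hsub : p.closedBall 0 1 ⊆ C)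
    (hcomp : @IsCompact X τ' C) :
    ∃ p : Seminorm 𝕜 X, IsNormInducing τ p ∧
      @IsCompact X τ' (p.closedBall 0 1) := by
  obtain ⟨q, hq1, hq2⟩ := exists_seminorm_of_absConvex hC fun x => by
    have hr : 0 < p x + 1 := by linarith [apply_nonneg p x]
    refine ⟨(((p x + 1)⁻¹ : ℝ) : 𝕜), ?_, hsub (inv_smul_mem_closedBall p hr (by linarith))⟩
    exact RCLike.ofReal_ne_zero.2 (inv_ne_zero hr.ne')
  obtain ⟨M, hM, hCM⟩ := hp.isBdd_iff.1 hb
  have hqp : ∀ x, q x ≤ 1 * p x := Seminorm.le_mul_of_closedBall hp.eq_zero fun x hx => by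
    simpa using hq2 (hsub hx)
  -- Only the open unit ball of the gauge is known to lie in `C`, so the comparison starts from a
  -- strict bound and lets `ε` tend to zero.
  have hpM : ∀ x, ∀ r > 0, q x < r → p x ≤ M * r := by
    intro x r hr hx
    have h1 : ((r⁻¹ : ℝ) : 𝕜) • x ∈ q.ball 0 1 := by
      rwa [Seminorm.mem_ball_zero, map_smul_eq_mul, norm_ofReal_inv hr, inv_mul_lt_iff₀ hr,
        mul_one]
    have := hCM _ (hq1 h1)
    rw [map_smul_eq_mul, norm_ofReal_inv hr, inv_mul_le_iff₀ hr] at this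
    linarith
  have hpq : ∀ x, p x ≤ M * q x := by
    intro x
    refine le_of_forall_pos_le_add fun ε hε => ?_
    have := hpM x (q x + ε / M) (add_pos_of_nonneg_of_pos (apply_nonneg _ _) (by positivity))
      (by linarith [div_pos hε hM])
    rwa [mul_add, mul_div_cancel₀ _ hM.ne'] at this
  refine ⟨q, hp.congr hpq hqp, ?_⟩
  let := τ'
  have := hτ'.t2
  have := hτ'.polynormable
  have := PolynormableSpace.continuousSMul (𝕜 := 𝕜) (X := X)
  -- Closedness of `C` upgrades the gauge inclusions to equality: if `q x ≤ 1`, the multiples `(1 -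
  -- 1 / (n + 1)) • x` lie in the open ball and tend to `x`.
  suffices h : q.closedBall 0 1 = C by rwa [h]
  refine Set.Subset.antisymm (fun x hx => ?_) hq2
  rw [Seminorm.mem_closedBall_zero] at hx
  have hlim : Tendsto (fun n : ℕ => (((1 - 1 / ((n : ℝ) + 1) : ℝ)) : 𝕜) • x) atTop (𝓝 x) := by
    have h1 : Tendsto (fun n : ℕ => (((1 - 1 / ((n : ℝ) + 1) : ℝ)) : 𝕜)) atTop (𝓝 1) := by
      have h2 : Tendsto (fun n : ℕ => 1 - 1 / ((n : ℝ) + 1)) atTop (𝓝 (1 - 0)) :=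
        tendsto_const_nhds.sub tendsto_one_div_add_atTop_nhds_zero_nat
      have h3 := (RCLike.continuous_ofReal (K := 𝕜)).tendsto (1 - 0 : ℝ)
      rw [sub_zero, RCLike.ofReal_one] at h3
      rw [sub_zero] at h2
      exact h3.comp h2
    have := h1.smul_const x
    rwa [one_smul] at this
  refine hcomp.isClosed.mem_of_tendsto hlim (Eventually.of_forall fun n => hq1 ?_)
  have h1 : (0 : ℝ) < 1 / ((n : ℝ) + 1) := by positivity
  have h2 : 1 / ((n : ℝ) + 1) ≤ 1 := by
    rw [div_le_one (by positivity)]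
    linarith [(Nat.cast_nonneg n : (0 : ℝ) ≤ n)]
  rw [Seminorm.mem_ball_zero, map_smul_eq_mul, RCLike.norm_ofReal, abs_of_nonneg (by linarith)]
  exact (mul_le_of_le_one_right (by linarith) hx).trans_lt (by linarith)

theorem exists_isMixedBasis (hp : IsNormInducing τ p) (hτ' : IsLCH 𝕜 τ') {C : Set X}
    (hC : AbsConvex 𝕜 C) (hCb : IsBdd 𝕜 τ C) (hcl : IsClosed[τ'] C) (hsub : p.closedBall 0 1 ⊆ C) :
    ∃ B, IsMixedBasis 𝕜 τ τ' B := by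
  let := τ'
  have := hτ'.polynormable
  have := PolynormableSpace.continuousSMul (𝕜 := 𝕜) (X := X)
  obtain ⟨M, hM, hCM⟩ := hp.isBdd_iff.1 hCb
  -- Dyadic dilates of `C` absorb every bounded set since `C` contains a unit ball.
  refine ⟨fun n => (2 ^ n : 𝕜) • C, ?_, ?_, ?_, ?_, ?_, ?_⟩
  · exact fun n => ⟨_, Set.smul_mem_smul_set (hsub (by simp : (0 : X) ∈ _))⟩
  · exact fun n => AbsConvex.smul_set hC _
  · intro n
    refine hp.isBdd_iff.2 ⟨2 ^ n * M, by positivity, ?_⟩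
    rintro _ ⟨x, hx, rfl⟩
    change p ((2 ^ n : 𝕜) • x) ≤ _
    rw [map_smul_eq_mul, norm_pow, RCLike.norm_two]
    gcongr
    exact hCM x hx
  · exact fun n => hcl.smul_of_ne_zero (by positivity)
  · intro D hD
    obtain ⟨r, hr, hDr⟩ := hp.isBdd_iff.1 hD
    obtain ⟨n, hn⟩ := pow_unbounded_of_one_lt r (one_lt_two : (1 : ℝ) < 2)
    refine ⟨n, fun x hx => ?_⟩
    have h2 : (0 : ℝ) < 2 ^ n := by positivity
    have := inv_smul_mem_closedBall p h2 ((hDr x hx).trans hn.le)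
    refine ⟨_, hsub this, ?_⟩
    have h3 := ofReal_inv_smul_smul (𝕜 := 𝕜) h2 x
    push_cast at h3 ⊢
    exact h3
  · intro n
    rw [smul_smul, ← pow_succ']

theorem exists_isMixedBasis_of_isClosed (hp : IsNormInducing τ p) (hτ' : IsLCH 𝕜 τ')
    (hcl : IsClosed[τ'] (p.closedBall 0 1)) : ∃ B, IsMixedBasis 𝕜 τ τ' B :=
  exists_isMixedBasis hp hτ' (Seminorm.absConvex_closedBall p 1) (hp.isBdd_closedBall 1) hcl
    Set.Subset.rfl

/-- The mixed topology has more bounded sets than `τ`. -/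
theorem isBdd_mixedTopology (hp : IsNormInducing τ p) (hτ' : IsLCH 𝕜 τ') (hle : τ ≤ τ')
    (hB : ∃ B, IsMixedBasis 𝕜 τ τ' B) {C : Set X} (hC : IsBdd 𝕜 τ C) :
    IsBdd 𝕜 (mixedTopology 𝕜 τ τ') C := by
  refine (@WithSeminorms.isVonNBounded_iff_seminorm_bounded _ _ _ _ _ _ _ (_) _
    (withSeminorms_mixedTopology hp.isLCH hτ' hB)).2 ?_
  rintro ⟨q, hq⟩
  obtain ⟨r, hr, hCr⟩ := hp.isBdd_iff.1 hC
  have h1 := hq _ (hp.isBdd_closedBall 1) 1 one_pos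
  obtain ⟨s, hs, hsub⟩ := hp.mem_nhds_zero_iff.1 (nhds_mono hle h1)
  -- `2 ^ m > r / s` brings `C` into the `s`-ball and `2 ^ m > r` into the unit ball; on their
  -- intersection `q < 1`.
  obtain ⟨m, hm⟩ := pow_unbounded_of_one_lt ((r / s) ⊔ r) (one_lt_two : (1 : ℝ) < 2)
  have h2 : (0 : ℝ) < 2 ^ m := by positivity
  refine ⟨2 ^ m, h2, fun x hx => ?_⟩
  have hx1 := hCr x hx
  have h3 : ((((2 : ℝ) ^ m)⁻¹ : ℝ) : 𝕜) • x ∈ p.ball 0 s := by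
    rw [Seminorm.mem_ball_zero, map_smul_eq_mul, norm_ofReal_inv h2, inv_mul_lt_iff₀ h2]
    have := (le_max_left _ _).trans_lt hm
    rw [div_lt_iff₀ hs] at this
    linarith
  have h4 := hsub h3 (inv_smul_mem_closedBall p h2 (hx1.trans ((le_max_right _ _).trans hm.le)))
  rwa [map_smul_eq_mul, norm_ofReal_inv h2, inv_mul_lt_iff₀ h2, mul_one] at h4

/-- If the unit ball is `τ'`-closed, then every set which is bounded for the mixed topology
is bounded. -/
theorem isBdd_of_mixedTopology (hp : IsNormInducing τ p) (hτ' : IsLCH 𝕜 τ')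
    (hcl : IsClosed[τ'] (p.closedBall 0 1)) {C : Set X}
    (hC : IsBdd 𝕜 (mixedTopology 𝕜 τ τ') C) : IsBdd 𝕜 τ C := by
  have hB := exists_isMixedBasis_of_isClosed hp hτ' hcl
  by_contra hcon
  -- The growth `4 ^ n` is chosen to beat the weights `2 ^ (-n)` below.
  have hx : ∀ n : ℕ, ∃ x ∈ C, (4 : ℝ) ^ n < p x := by
    intro n
    by_contra! h
    exact hcon (hp.isBdd_iff.2 ⟨4 ^ n, by positivity, h⟩)
  choose x hxC hxp using hx
  -- `4 ^ (-n) • x n` lies outside the `τ'`-closed unit ball and is separated from it by a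
  -- `τ'`-continuous functional.
  have hℓ : ∀ n, ∃ ℓ : X →ₗ[𝕜] 𝕜, @Continuous X 𝕜 τ' _ ℓ ∧ (∀ y, ‖ℓ y‖ ≤ p y) ∧
      (4 : ℝ) ^ n < ‖ℓ (x n)‖ := by
    intro n
    let := τ'
    have := hτ'.polynormable
    have h4 : (0 : ℝ) < 4 ^ n := by positivity
    obtain ⟨ℓ, h1, h2⟩ := PolynormableSpace.exists_separating (𝕜 := 𝕜)
      (Seminorm.absConvex_closedBall p 1) ⟨0, by simp⟩ hcl
      (x := ((((4 : ℝ) ^ n)⁻¹ : ℝ) : 𝕜) • x n) (by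
        rw [Seminorm.mem_closedBall_zero, map_smul_eq_mul, norm_ofReal_inv h4, not_le,
          lt_inv_mul_iff₀ h4, mul_one]
        exact hxp n)
    refine ⟨ℓ, ℓ.continuous, fun y => ?_, ?_⟩
    · simpa using Seminorm.le_mul_of_closedBall hp.eq_zero
        (q := (normSeminorm 𝕜 𝕜).comp (ℓ : X →ₗ[𝕜] 𝕜)) h1 y
    · rwa [map_smul, norm_smul, norm_ofReal_inv h4, lt_inv_mul_iff₀ h4, mul_one] at h2
  choose ℓ hℓc hℓp hℓx using hℓ
  let Q : ℕ → Seminorm 𝕜 X := fun n => ((1 / 2 : NNReal) ^ n) • (normSeminorm 𝕜 𝕜).comp (ℓ n)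
  have hQ : ∀ n y, Q n y = (1 / 2 : ℝ) ^ n * ‖ℓ n y‖ := by
    intro n y
    simp [Q, NNReal.smul_def]
  have hQp : ∀ n y, Q n y ≤ (1 / 2 : ℝ) ^ n * p y := by
    intro n y
    rw [hQ]
    gcongr
    exact hℓp n y
  have hbdd : BddAbove (Set.range Q) := by
    refine ⟨p, ?_⟩
    rintro _ ⟨n, rfl⟩ y
    refine (hQp n y).trans (mul_le_of_le_one_left (apply_nonneg p y) ?_)
    exact pow_le_one₀ (by norm_num) (by norm_num)
  -- Along a bounded set the terms with `n ≥ N` are uniformly small by `Q n ≤ 2 ^ (-n) p`; the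
  -- finitely many others are small near zero by `τ'`-continuity.
  have hq : (⨆ n, Q n) ∈ mixedSeminorms 𝕜 τ τ' := by
    intro D hD ε hε
    obtain ⟨r, hr, hDr⟩ := hp.isBdd_iff.1 hD
    obtain ⟨N, hN⟩ := exists_pow_lt_of_lt_one (div_pos hε (mul_pos two_pos hr))
      (by norm_num : (1 / 2 : ℝ) < 1)
    have hev : ∀ᶠ y in @nhds X τ' 0, ∀ n ∈ Finset.range N, ‖ℓ n y‖ < ε / 2 := by
      refine (Finset.eventually_all _).2 fun n _ => ?_
      let := τ'
      have : Tendsto (fun y => ‖ℓ n y‖) (𝓝 0) (𝓝 0) := by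
        have hc : Continuous fun y => ‖ℓ n y‖ := (hℓc n).norm
        simpa using hc.tendsto 0
      exact this.eventually_lt_const (half_pos hε)
    filter_upwards [hev] with y hy hyD
    rw [Seminorm.iSup_apply hbdd]
    refine lt_of_le_of_lt (ciSup_le fun n => ?_) (half_lt_self hε)
    rcases lt_or_ge n N with hn | hn
    · rw [hQ]
      refine (mul_le_of_le_one_left (norm_nonneg _) ?_).trans (hy n (Finset.mem_range.2 hn)).le
      exact pow_le_one₀ (by norm_num) (by norm_num)
    · refine (hQp n y).trans ?_
      calc (1 / 2 : ℝ) ^ n * p y ≤ (1 / 2) ^ N * r := by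
            have := pow_le_pow_of_le_one (by norm_num : (0 : ℝ) ≤ 1 / 2) (by norm_num) hn
            exact mul_le_mul this (hDr y hyD) (apply_nonneg p y) (by positivity)
        _ ≤ ε / (2 * r) * r := by gcongr
        _ = ε / 2 := by field_simp
  obtain ⟨r, hr, hCr⟩ := (@WithSeminorms.isVonNBounded_iff_seminorm_bounded _ _ _ _ _ _ _ (_) _
    (withSeminorms_mixedTopology hp.isLCH hτ' hB)).1 hC ⟨_, hq⟩
  obtain ⟨n, hn⟩ := pow_unbounded_of_one_lt r (one_lt_two : (1 : ℝ) < 2)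
  have h1 := hCr _ (hxC n)
  have h2 : Q n (x n) ≤ (⨆ n, Q n) (x n) := by
    rw [Seminorm.iSup_apply hbdd]
    exact le_ciSup (Seminorm.bddAbove_range_iff.1 hbdd (x n)) n
  rw [hQ] at h2
  -- The supremum exceeds `2 ^ n` at `x n`, which contradicts its boundedness by `r` on `C`.
  have h3 : (1 / 2 : ℝ) ^ n * 4 ^ n < (1 / 2 : ℝ) ^ n * ‖ℓ n (x n)‖ := by
    have := hℓx n
    gcongr
  rw [← mul_pow] at h3
  norm_num at h3
  norm_num at h1 h2
  linarith

theorem sameBounded_mixedTopology (hp : IsNormInducing τ p) (hτ' : IsLCH 𝕜 τ') (hle : τ ≤ τ')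
    (hcl : IsClosed[τ'] (p.closedBall 0 1)) : SameBounded 𝕜 τ (mixedTopology 𝕜 τ τ') :=
  fun _ => ⟨isBdd_mixedTopology hp hτ' hle (exists_isMixedBasis_of_isClosed hp hτ' hcl),
    isBdd_of_mixedTopology hp hτ' hcl⟩

/-- On bounded sets the mixed topology is coarser than `τ'`. -/
theorem continuousOn_id_mixedTopology (hp : IsNormInducing τ p) (hτ' : IsLCH 𝕜 τ')
    (hB : ∃ B, IsMixedBasis 𝕜 τ τ' B) {C : Set X} (hC : IsBdd 𝕜 τ C) :
    @ContinuousOn X X τ' (mixedTopology 𝕜 τ τ') id C := by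
  have hw := withSeminorms_mixedTopology hp.isLCH hτ' hB
  intro x hx
  refine (@WithSeminorms.tendsto_nhds _ _ _ _ _ _ _ (mixedTopology 𝕜 τ τ') _ hw _ _ _).2 ?_
  rintro ⟨q, hq⟩ ε hε
  -- Continuity at `x` along `C` is continuity at zero along the bounded set `C - C`.
  have hD : IsBdd 𝕜 τ (C - C) := by
    obtain ⟨r, hr, hCr⟩ := hp.isBdd_iff.1 hC
    refine hp.isBdd_iff.2 ⟨r + r, by positivity, ?_⟩
    rintro _ ⟨a, ha, b, hb, rfl⟩
    exact (map_sub_le_add p a b).trans (add_le_add (hCr a ha) (hCr b hb))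
  let := τ'
  have := hτ'.polynormable
  have := PolynormableSpace.isTopologicalAddGroup (𝕜 := 𝕜) (X := X)
  have ht : Tendsto (fun y => y - x) (𝓝[C] x) (𝓝 0) := by
    have : Tendsto (fun y => y - x) (𝓝 x) (𝓝 0) := by
      simpa using (continuous_sub_right x).tendsto x
    exact this.mono_left nhdsWithin_le_nhds
  filter_upwards [ht.eventually (hq _ hD ε hε), self_mem_nhdsWithin] with y hy hyC
  exact hy ⟨y, hyC, x, hx, rfl⟩

theorem isCompact_mixedTopology (hp : IsNormInducing τ p) (hτ' : IsLCH 𝕜 τ')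
    (hB : ∃ B, IsMixedBasis 𝕜 τ τ' B) {C : Set X} (hC : IsBdd 𝕜 τ C) (hcomp : @IsCompact X τ' C) :
    @IsCompact X (mixedTopology 𝕜 τ τ') C := by
  have := @IsCompact.image_of_continuousOn X X τ' (mixedTopology 𝕜 τ τ') C id hcomp
    (continuousOn_id_mixedTopology hp hτ' hB hC)
  rwa [Set.image_id] at this

/-- A linear functional which is continuous on the unit ball for the mixed topology is continuous for
the mixed topology. -/
theorem continuous_mixedTopology_of_continuousOn (hp : IsNormInducing τ p) (hτ' : IsLCH 𝕜 τ')
    (hB : ∃ B, IsMixedBasis 𝕜 τ τ' B) (ℓ : X →ₗ[𝕜] 𝕜)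
    (hγ : @ContinuousOn X 𝕜 (mixedTopology 𝕜 τ τ') _ ℓ (p.closedBall 0 1)) :
    @Continuous X 𝕜 (mixedTopology 𝕜 τ τ') _ ℓ := by
  have h : @ContinuousOn X 𝕜 τ' _ ℓ (p.closedBall 0 1) :=
    @ContinuousOn.comp X X 𝕜 τ' (mixedTopology 𝕜 τ τ') _ id _ ℓ _ hγ
      (continuousOn_id_mixedTopology hp hτ' hB (hp.isBdd_closedBall 1)) (Set.mapsTo_id _)
  rw [continuous_mixedTopology_iff hp.isLCH hτ' hB]
  intro C hC ε hε
  obtain ⟨r, hr, hCr⟩ := hp.isBdd_iff.1 hC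
  have h0 : ∀ᶠ x in @nhds X τ' 0, x ∈ p.closedBall 0 1 → ‖ℓ x‖ < r⁻¹ * ε := by
    let := τ'
    have h1 : Tendsto ℓ (𝓝[p.closedBall 0 1] 0) (𝓝 0) := by
      have := h 0 (by simp)
      rwa [ContinuousWithinAt, map_zero] at this
    have h2 := (tendsto_zero_iff_norm_tendsto_zero.1 h1).eventually_lt_const
      (show (0 : ℝ) < r⁻¹ * ε by positivity)
    exact eventually_nhdsWithin_iff.1 h2
  filter_upwards [eventually_smul_mem hτ' h0 ((r⁻¹ : ℝ) : 𝕜)] with x hx hxC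
  have := hx (inv_smul_mem_closedBall p hr (hCr x hxC))
  rw [map_smul, norm_smul, norm_ofReal_inv hr] at this
  exact lt_of_mul_lt_mul_left this (inv_pos.2 hr).le

end MixedNormed

/-! ### Strong duals, completeness and the bidual. -/

section Dual

variable {𝕜 : Type v} [RCLike 𝕜] {X : Type w} [AddCommGroup X] [Module 𝕜 X]

theorem IsNormInducing.of_mem_nhds [σ : TopologicalSpace X] [IsTopologicalAddGroup X]
    {q : Seminorm 𝕜 X} (h0 : ∀ x, q x = 0 → x = 0)
    (h : ∀ U : Set X, U ∈ 𝓝 0 ↔ ∃ r > 0, q.ball 0 r ⊆ U) : IsNormInducing σ q := by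
  refine ⟨h0, (SeminormFamily.withSeminorms_iff_nhds_eq_iInf _).2 ?_⟩
  rw [iInf_const]
  ext U
  rw [h, (Metric.nhds_basis_ball.comap q).mem_iff]
  refine exists_congr fun r => and_congr_right fun _ => ?_
  suffices q.ball 0 r = q ⁻¹' Metric.ball 0 r by rw [this]
  ext x
  simp [abs_of_nonneg (apply_nonneg q x)]

section

variable [TopologicalSpace X]

/-- The seminorm of uniform convergence on `C`. -/
noncomputable def dualSeminorm (C : Set X) : Seminorm 𝕜 (StrongDual 𝕜 X) :=
  ⨆ x : C, (normSeminorm 𝕜 𝕜).comp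
    ({ toFun := fun ℓ => ℓ x, map_add' := fun _ _ => rfl, map_smul' := fun _ _ => rfl } :
      StrongDual 𝕜 X →ₗ[𝕜] 𝕜)

variable {C : Set X}

theorem bddAbove_dualSeminorm (hC : IsVonNBounded 𝕜 C) (ℓ : StrongDual 𝕜 X) :
    ∃ M, ∀ x ∈ C, ‖ℓ x‖ ≤ M := by
  obtain ⟨M, hM⟩ := (NormedSpace.isVonNBounded_iff' 𝕜).1 (hC.image ℓ)
  exact ⟨M, fun x hx => hM _ (Set.mem_image_of_mem _ hx)⟩

theorem dualSeminorm_apply (hC : IsVonNBounded 𝕜 C) (ℓ : StrongDual 𝕜 X) :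
    dualSeminorm C ℓ = ⨆ x : C, ‖ℓ x‖ := by
  refine Seminorm.iSup_apply (Seminorm.bddAbove_range_iff.2 fun ℓ => ?_)
  obtain ⟨M, hM⟩ := bddAbove_dualSeminorm hC ℓ
  refine ⟨M, ?_⟩
  rintro _ ⟨x, rfl⟩
  exact hM x x.2

theorem norm_le_dualSeminorm (hC : IsVonNBounded 𝕜 C) (ℓ : StrongDual 𝕜 X) {x : X} (hx : x ∈ C) :
    ‖ℓ x‖ ≤ dualSeminorm C ℓ := by
  rw [dualSeminorm_apply hC]
  obtain ⟨M, hM⟩ := bddAbove_dualSeminorm hC ℓ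
  exact le_ciSup (f := fun x : C => ‖ℓ x‖) ⟨M, by rintro _ ⟨x, rfl⟩; exact hM x x.2⟩ ⟨x, hx⟩

theorem dualSeminorm_le (hC : IsVonNBounded 𝕜 C) (ℓ : StrongDual 𝕜 X) {M : ℝ} (hM : 0 ≤ M)
    (h : ∀ x ∈ C, ‖ℓ x‖ ≤ M) : dualSeminorm C ℓ ≤ M := by
  rw [dualSeminorm_apply hC]
  exact Real.iSup_le (fun x => h x x.2) hM

theorem dualSeminorm_ball_mem_nhds (hC : IsVonNBounded 𝕜 C) {r : ℝ} (hr : 0 < r) :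
    (dualSeminorm C).ball (0 : StrongDual 𝕜 X) r ∈ 𝓝 0 := by
  refine ContinuousLinearMap.hasBasis_nhds_zero.mem_iff.2
    ⟨(C, Metric.ball 0 (r / 2)), ⟨hC, Metric.ball_mem_nhds _ (half_pos hr)⟩, fun ℓ hℓ => ?_⟩
  rw [Seminorm.mem_ball_zero]
  exact (dualSeminorm_le hC ℓ (half_pos hr).le fun x hx =>
    (mem_ball_zero_iff.1 (hℓ x hx)).le).trans_lt (half_lt_self hr)

variable {p : Seminorm 𝕜 X}

theorem norm_le_dualSeminorm_mul (h0 : ∀ x, p x = 0 → x = 0)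
    (hC : IsVonNBounded 𝕜 (p.closedBall 0 1)) (ℓ : StrongDual 𝕜 X) (x : X) :
    ‖ℓ x‖ ≤ dualSeminorm (p.closedBall 0 1) ℓ * p x := by
  simpa using Seminorm.le_mul_of_closedBall h0
    (q := (normSeminorm 𝕜 𝕜).comp (ℓ : X →ₗ[𝕜] 𝕜)) (fun x hx => norm_le_dualSeminorm hC ℓ hx) x

/-- If the bounded sets are those of a norm `p`, then the strong dual carries the dual norm. -/
theorem isNormInducing_dualSeminorm (h0 : ∀ x, p x = 0 → x = 0)
    (hb : ∀ C : Set X, IsVonNBounded 𝕜 C ↔ ∃ r > 0, ∀ x ∈ C, p x ≤ r) :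
    IsNormInducing (inferInstance : TopologicalSpace (StrongDual 𝕜 X))
      (dualSeminorm (p.closedBall 0 1)) := by
  have hB : IsVonNBounded 𝕜 (p.closedBall 0 1) := (hb _).2 ⟨1, one_pos, fun x hx => by simpa using hx⟩
  refine IsNormInducing.of_mem_nhds (fun ℓ hℓ => ?_) fun U => ⟨fun hU => ?_, ?_⟩
  · ext x
    have := norm_le_dualSeminorm_mul h0 hB ℓ x
    rw [hℓ, zero_mul] at this
    simpa using this
  · obtain ⟨⟨S, V⟩, ⟨hS, hV⟩, hSV⟩ := ContinuousLinearMap.hasBasis_nhds_zero.mem_iff.1 hU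
    obtain ⟨r, hr, hSr⟩ := (hb S).1 hS
    obtain ⟨ε, hε, hV⟩ := Metric.mem_nhds_iff.1 hV
    refine ⟨ε / r, by positivity, fun ℓ hℓ => hSV fun x hx => hV ?_⟩
    rw [Seminorm.mem_ball_zero, lt_div_iff₀ hr] at hℓ
    rw [mem_ball_zero_iff]
    exact (norm_le_dualSeminorm_mul h0 hB ℓ x).trans_lt ((mul_le_mul_of_nonneg_left (hSr x hx)
      (apply_nonneg _ _)).trans_lt hℓ)
  · rintro ⟨r, hr, h⟩
    exact mem_of_superset (dualSeminorm_ball_mem_nhds hB hr) h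

/-- Completeness of the strong dual when continuity of functionals can be tested on the unit
ball. -/
theorem completelyNormable_strongDual (h0 : ∀ x, p x = 0 → x = 0)
    (hb : ∀ C : Set X, IsVonNBounded 𝕜 C ↔ ∃ r > 0, ∀ x ∈ C, p x ≤ r)
    (hc : ∀ ℓ : X →ₗ[𝕜] 𝕜, ContinuousOn ℓ (p.closedBall 0 1) → Continuous ℓ) :
    CompletelyNormable 𝕜 (inferInstance : TopologicalSpace (StrongDual 𝕜 X)) := by
  have hB : IsVonNBounded 𝕜 (p.closedBall 0 1) := (hb _).2 ⟨1, one_pos, fun x hx => by simpa using hx⟩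
  refine ⟨dualSeminorm (p.closedBall 0 1), isNormInducing_dualSeminorm h0 hb, fun s hs => ?_⟩
  have hpt : ∀ x, ∃ y, Tendsto (fun n => s n x) atTop (𝓝 y) := by
    intro x
    refine cauchySeq_tendsto_of_complete (Metric.cauchySeq_iff.2 fun ε hε => ?_)
    obtain ⟨N, hN⟩ := hs (ε / (p x + 1)) (div_pos hε (by linarith [apply_nonneg p x]))
    refine ⟨N, fun m hm n hn => ?_⟩
    have h1 := hN m hm n hn
    rw [lt_div_iff₀ (by linarith [apply_nonneg p x])] at h1
    rw [dist_eq_norm]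
    have h2 := norm_le_dualSeminorm_mul h0 hB (s m - s n) x
    have h3 := apply_nonneg (dualSeminorm (𝕜 := 𝕜) (p.closedBall 0 1)) (s m - s n)
    rw [sub_apply] at h2
    linarith
  choose g hg using hpt
  let G : X →ₗ[𝕜] 𝕜 := linearMapOfTendsto g (fun n => (s n : X →ₗ[𝕜] 𝕜)) (tendsto_pi_nhds.2 hg)
  have hunif : ∀ ε > 0, ∃ N, ∀ n ≥ N, ∀ x ∈ p.closedBall 0 1, ‖s n x - g x‖ ≤ ε := by
    intro ε hε
    obtain ⟨N, hN⟩ := hs ε hε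
    refine ⟨N, fun n hn x hx => ?_⟩
    refine le_of_tendsto ((tendsto_const_nhds (x := s n x)).sub (hg x)).norm ?_
    filter_upwards [eventually_ge_atTop N] with m hm
    exact (norm_le_dualSeminorm hB (s n - s m) hx).trans (hN n hn m hm).le
  -- The pointwise limit is uniform on the unit ball, hence continuous there, and `hc` extends this
  -- to the whole space.
  have hGc : Continuous G := by
    refine hc G (TendstoUniformlyOn.continuousOn (F := fun n x => s n x) (p := atTop) ?_
      (Frequently.of_forall fun n => (s n).continuous.continuousOn))
    refine Metric.tendstoUniformlyOn_iff.2 fun ε hε => ?_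
    obtain ⟨N, hN⟩ := hunif (ε / 2) (half_pos hε)
    filter_upwards [eventually_ge_atTop N] with n hn x hx
    rw [dist_comm, dist_eq_norm]
    exact (hN n hn x hx).trans_lt (half_lt_self hε)
  refine ⟨⟨G, hGc⟩, ?_⟩
  refine Metric.tendsto_atTop.2 fun ε hε => ?_
  obtain ⟨N, hN⟩ := hunif (ε / 2) (half_pos hε)
  refine ⟨N, fun n hn => ?_⟩
  rw [Real.dist_0_eq_abs, abs_of_nonneg (apply_nonneg _ _)]
  exact (dualSeminorm_le hB _ (half_pos hε).le fun x hx => hN n hn x hx).trans_lt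
    (half_lt_self hε)

variable (𝕜 X) in
/-- The evaluation map of a space into its strong bidual. -/
def evalBidual [ContinuousSMul 𝕜 X] : X →ₗ[𝕜] StrongDual 𝕜 (StrongDual 𝕜 X) where
  toFun x :=
    { toFun := fun ℓ => ℓ x
      map_add' := fun _ _ => rfl
      map_smul' := fun _ _ => rfl
      cont := continuous_eval_const x }
  map_add' x y := by ext ℓ; exact map_add ℓ x y
  map_smul' c x := by ext ℓ; exact map_smul ℓ c x

@[simp]
theorem evalBidual_apply [ContinuousSMul 𝕜 X] (x : X) (ℓ : StrongDual 𝕜 X) : evalBidual 𝕜 X x ℓ = ℓ x := rfl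

theorem PolynormableSpace.eq_of_forall_eq [PolynormableSpace 𝕜 X] [T2Space X] {x y : X}
    (h : ∀ ℓ : StrongDual 𝕜 X, ℓ x = ℓ y) : x = y := by
  by_contra hne
  obtain ⟨ℓ, h1, h2⟩ := PolynormableSpace.exists_separating (𝕜 := 𝕜) (C := ({0} : Set X))
    ⟨balanced_zero, convex_singleton 0⟩ ⟨0, rfl⟩ isClosed_singleton (x := x - y)
    (by simpa [sub_eq_zero] using hne)
  rw [map_sub, h ℓ, sub_self, norm_zero] at h2
  linarith

/-- A functional on the strong dual which is dominated by the dual norm is the evaluation at a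
point if the unit ball is compact. -/
theorem exists_eq_evalBidual (hb : IsVonNBounded 𝕜 (p.closedBall 0 1))
    [T2Space X] [PolynormableSpace 𝕜 X]
    (hK : IsCompact (p.closedBall 0 1)) (φ : StrongDual 𝕜 X →ₗ[𝕜] 𝕜) {M : ℝ} (hM : 0 < M)
    (hφ : ∀ ℓ, ‖φ ℓ‖ ≤ M * dualSeminorm (p.closedBall 0 1) ℓ) :
    ∃ x, p x ≤ M ∧ ∀ ℓ, φ ℓ = ℓ x := by
  have := PolynormableSpace.continuousSMul (𝕜 := 𝕜) (X := X)
  have hKM := isCompact_closedBall_of_one hK hM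
  -- By compactness it suffices to match `φ` on finitely many functionals by a point of the
  -- `M`-ball.
  obtain ⟨x, hx, hxφ⟩ := hKM.inter_iInter_nonempty (fun ℓ : StrongDual 𝕜 X => {x | ℓ x = φ ℓ})
    (fun ℓ => isClosed_eq ℓ.continuous continuous_const) fun u => by
      classical
      by_contra hcon
      let T : X →ₗ[𝕜] (u → 𝕜) := LinearMap.pi fun ℓ => (ℓ.1 : X →ₗ[𝕜] 𝕜)
      have hT : Continuous T := continuous_pi fun ℓ => ℓ.1.continuous
      have hTA : AbsConvex 𝕜 (T '' p.closedBall 0 M) := by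
        have hA := Seminorm.absConvex_closedBall p M
        refine ⟨?_, hA.2.linear_image T⟩
        rintro a ha _ ⟨_, ⟨x, hx, rfl⟩, rfl⟩
        exact ⟨a • x, hA.1.smul_mem ha hx, map_smul T a x⟩
      -- If no such point exists, the values of `φ` are separated in `u → 𝕜` from the compact image
      -- of the `M`-ball. The separating functional pulls back to `L` of dual norm at most `M⁻¹`,
      -- although `‖φ L‖ > 1`.
      obtain ⟨f, hf1, hf2⟩ := PolynormableSpace.exists_separating (𝕜 := 𝕜) hTA
        ⟨T 0, 0, by simpa using hM.le, rfl⟩ (hKM.image hT).isClosed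
        (x := fun ℓ => φ ℓ.1) (by
          rintro ⟨x, hx, hxT⟩
          refine hcon ⟨x, hx, Set.mem_iInter₂.2 fun ℓ hℓ => ?_⟩
          exact congrFun hxT ⟨ℓ, hℓ⟩)
      have hf : ∀ z : u → 𝕜, f z = ∑ ℓ, z ℓ * f (Pi.single ℓ 1) := by
        intro z
        conv_lhs => rw [pi_eq_sum_univ' z]
        rw [map_sum]
        refine Finset.sum_congr rfl fun ℓ _ => ?_
        rw [map_smul, smul_eq_mul]
      let L : StrongDual 𝕜 X := ∑ ℓ : u, f (Pi.single ℓ 1) • ℓ.1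
      have hL : ∀ x, L x = f (T x) := by
        intro x
        rw [hf]
        simp [L, T, mul_comm]
      have hφL : φ L = f fun ℓ => φ ℓ.1 := by
        rw [hf]
        simp [L, mul_comm]
      have hLM : dualSeminorm (p.closedBall 0 1) L ≤ M⁻¹ := by
        refine dualSeminorm_le hb L (inv_pos.2 hM).le fun x hx => ?_
        have := hf1 (T ((M : 𝕜) • x)) ⟨_, by
          rw [Seminorm.mem_closedBall_zero] at hx ⊢
          rw [map_smul_eq_mul, RCLike.norm_ofReal, abs_of_pos hM]
          exact mul_le_of_le_one_right hM.le hx, rfl⟩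
        rw [← hL, map_smul, norm_smul, RCLike.norm_ofReal, abs_of_pos hM] at this
        rwa [← mul_one M⁻¹, le_inv_mul_iff₀ hM]
      have h1 := hφ L
      rw [hφL] at h1
      have h2 : M * dualSeminorm (p.closedBall 0 1) L ≤ M * M⁻¹ := by gcongr
      rw [mul_inv_cancel₀ hM.ne'] at h2
      linarith
  exact ⟨x, by simpa using hx, fun ℓ => (Set.mem_iInter.1 hxφ ℓ).symm⟩

end

theorem IsNormInducing.continuous {τ : TopologicalSpace X} {p : Seminorm 𝕜 X}
    (hp : IsNormInducing τ p) {Z : Type*} [AddCommGroup Z] [Module 𝕜 Z] {σ : TopologicalSpace Z}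
    {q : Seminorm 𝕜 Z} (hq : IsNormInducing σ q) (T : X →ₗ[𝕜] Z) (h : ∀ x, q (T x) ≤ p x) :
    Continuous[τ, σ] T := by
  let := τ
  have := hp.induces.topologicalAddGroup
  have := hq.induces.topologicalAddGroup
  refine continuous_of_continuousAt_zero T ?_
  rw [ContinuousAt, map_zero]
  intro U hU
  obtain ⟨r, hr, h1⟩ := hq.mem_nhds_zero_iff.1 hU
  refine hp.mem_nhds_zero_iff.2 ⟨r, hr, fun x hx => h1 ?_⟩
  rw [Seminorm.mem_ball_zero] at hx ⊢
  exact (h x).trans_lt hx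

section

variable {τ γ : TopologicalSpace X} {p : Seminorm 𝕜 X}

/-- The evaluation map into the strong bidual is a topological isomorphism for the norm topology
if the unit ball is compact and defines the bounded sets. -/
theorem exists_isTopIso_bidual (hp : IsNormInducing τ p) (hγ : IsLCH 𝕜 γ)
    (hb : SameBounded 𝕜 τ γ) (hK : @IsCompact X γ (p.closedBall 0 1)) :
    ∃ φ : X ≃ₗ[𝕜] StrongDual 𝕜 (StrongDual 𝕜 X),
      IsTopIso τ φ ∧ ∀ x ℓ, φ x ℓ = ℓ x := by
  have := hγ.polynormable
  have := hγ.t2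
  have := PolynormableSpace.continuousSMul (𝕜 := 𝕜) (X := X)
  have hb' : ∀ C : Set X, IsVonNBounded 𝕜 C ↔ ∃ r > 0, ∀ x ∈ C, p x ≤ r :=
    fun C => (hb C).symm.trans hp.isBdd_iff
  have hB : IsVonNBounded 𝕜 (p.closedBall 0 1) := (hb _).1 (hp.isBdd_closedBall 1)
  have hD := isNormInducing_dualSeminorm hp.eq_zero hb'
  have hDD := isNormInducing_dualSeminorm hD.eq_zero fun C => hD.isBdd_iff
  have hBD := hD.isBdd_closedBall 1
  -- The bound `p x ≤ M` on the representing point gives surjectivity and also continuity of the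
  -- inverse.
  have hle : ∀ φ : StrongDual 𝕜 (StrongDual 𝕜 X), ∀ M > 0, dualSeminorm
      ((dualSeminorm (p.closedBall 0 1)).closedBall 0 1) φ ≤ M →
      ∃ x, p x ≤ M ∧ ∀ ℓ, φ ℓ = ℓ x := by
    intro φ M hM h
    refine exists_eq_evalBidual hB hK (φ : StrongDual 𝕜 X →ₗ[𝕜] 𝕜) hM fun ℓ => ?_
    exact (norm_le_dualSeminorm_mul hD.eq_zero hBD φ ℓ).trans
      (mul_le_mul_of_nonneg_right h (apply_nonneg _ _))
  have hinj : Function.Injective (evalBidual 𝕜 X) := fun x y hxy =>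
    PolynormableSpace.eq_of_forall_eq (𝕜 := 𝕜) fun ℓ => congrArg (fun g => g ℓ) hxy
  have hsurj : Function.Surjective (evalBidual 𝕜 X) := by
    intro φ
    obtain ⟨x, -, hx⟩ := hle φ (dualSeminorm _ φ + 1)
      (add_pos_of_nonneg_of_pos (apply_nonneg _ φ) one_pos) (by linarith)
    exact ⟨x, by ext ℓ; exact (hx ℓ).symm⟩
  refine ⟨LinearEquiv.ofBijective _ ⟨hinj, hsurj⟩, ⟨?_, ?_⟩, fun _ _ => rfl⟩
  · refine hp.continuous hDD (evalBidual 𝕜 X) fun x => ?_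
    refine dualSeminorm_le hBD _ (apply_nonneg p x) fun ℓ hℓ => ?_
    rw [evalBidual_apply]
    refine (norm_le_dualSeminorm_mul hp.eq_zero hB ℓ x).trans ?_
    rw [Seminorm.mem_closedBall_zero] at hℓ
    exact mul_le_of_le_one_left (apply_nonneg p x) hℓ
  · refine hDD.continuous hp
      (LinearEquiv.ofBijective _ ⟨hinj, hsurj⟩).symm.toLinearMap fun φ => ?_
    refine le_of_forall_pos_le_add fun ε hε => ?_
    obtain ⟨x, hx, hxφ⟩ := hle φ (dualSeminorm _ φ + ε)
      (add_pos_of_nonneg_of_pos (apply_nonneg _ _) hε) (by linarith)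
    have : φ = LinearEquiv.ofBijective _ ⟨hinj, hsurj⟩ x := by ext ℓ; exact hxφ ℓ
    rw [this, LinearEquiv.coe_coe, LinearEquiv.symm_apply_apply, ← this]
    exact hx

theorem semiMontel_of_isCompact (hp : IsNormInducing τ p) (hγ : IsLCH 𝕜 γ)
    (hb : SameBounded 𝕜 τ γ) (hK : @IsCompact X γ (p.closedBall 0 1)) : SemiMontel 𝕜 γ := by
  have := hγ.t2
  intro B hB
  obtain ⟨r, hr, hBr⟩ := hp.isBdd_iff.1 ((hb B).2 hB)
  refine (hγ.isCompact_closedBall hK hr).of_isClosed_subset isClosed_closure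
    (closure_minimal (fun x hx => ?_) (hγ.isClosed_closedBall hK hr))
  simpa using hBr x hx

end

end Dual

/-! ### Pointwise compactness in function spaces and the implications. -/

section FunctionSpace

variable {𝕜 : Type v} [RCLike 𝕜]

/-- Alaoglu without topology on `Z`: linearity is a closed condition inside a Tychonoff product of
closed balls. -/
theorem isCompact_linear_of_norm_le {Z : Type*} [AddCommGroup Z] [Module 𝕜 Z] (m : Z → ℝ) :
    IsCompact {φ : Z → 𝕜 | (∃ L : Z →ₗ[𝕜] 𝕜, ⇑L = φ) ∧ ∀ z, ‖φ z‖ ≤ m z} := by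
  have h1 : IsCompact (Set.univ.pi fun z => Metric.closedBall (0 : 𝕜) (m z)) :=
    isCompact_univ_pi fun z => isCompact_closedBall 0 (m z)
  refine h1.of_isClosed_subset ?_ fun φ hφ z _ => by simpa using hφ.2 z
  refine IsClosed.inter (LinearMap.isClosed_range_coe Z 𝕜 (RingHom.id 𝕜)) ?_
  change IsClosed {φ : Z → 𝕜 | ∀ z, ‖φ z‖ ≤ m z}
  simp only [Set.ofPred_forall]
  exact isClosed_iInter fun z => isClosed_le (continuous_apply z).norm continuous_const

variable {Ω : Type u} (F : Submodule 𝕜 (Ω → 𝕜)) {τ : TopologicalSpace F}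

theorem isCompact_pointwise_iff {S : Set F} :
    @IsCompact F (pointwiseTopology F) S ↔ IsCompact ((fun f : F => (f : Ω → 𝕜)) '' S) :=
  @IsInducing.isCompact_iff F (Ω → 𝕜) (pointwiseTopology F) _ _ _ (@IsInducing.mk _ _ (_) _ _ rfl)

/-- `S` is the image of the dominated functionals under composition with `δ`. It serves both (a),
with `Z` the predual, and (d), with `Z` the strong dual of the mixed topology. -/
theorem isCompact_pointwise_of_linear {Z : Type*} [AddCommGroup Z] [Module 𝕜 Z] (m : Z → ℝ)
    (δ : Ω → Z) {S : Set F} (h1 : ∀ f ∈ S, ∃ L : Z →ₗ[𝕜] 𝕜, (∀ z, ‖L z‖ ≤ m z) ∧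
      ∀ x, L (δ x) = (f : Ω → 𝕜) x)
    (h2 : ∀ L : Z →ₗ[𝕜] 𝕜, (∀ z, ‖L z‖ ≤ m z) → ∃ f ∈ S, ∀ x, L (δ x) = (f : Ω → 𝕜) x) :
    @IsCompact F (pointwiseTopology F) S := by
  rw [isCompact_pointwise_iff]
  have hc : Continuous fun (φ : Z → 𝕜) (x : Ω) => φ (δ x) :=
    continuous_pi fun x => continuous_apply (δ x)
  have := (isCompact_linear_of_norm_le (𝕜 := 𝕜) m).image hc
  convert this using 1
  ext g
  constructor
  · rintro ⟨f, hf, rfl⟩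
    obtain ⟨L, hL, hLf⟩ := h1 f hf
    exact ⟨L, ⟨⟨L, rfl⟩, hL⟩, funext hLf⟩
  · rintro ⟨_, ⟨⟨L, rfl⟩, hL⟩, rfl⟩
    obtain ⟨f, hf, hfL⟩ := h2 L hL
    exact ⟨f, hf, funext fun x => (hfL x).symm⟩

theorem continuous_pointEval (x : Ω) : @Continuous F 𝕜 (pointwiseTopology F) _ (pointEval F x) :=
  let := pointwiseTopology F
  (continuous_apply x).comp continuous_induced_dom

theorem isLCH_pointwiseTopology : IsLCH 𝕜 (pointwiseTopology F) := by
  refine ⟨PolynormableSpace.induced F.subtype, ?_⟩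
  let := pointwiseTopology F
  exact T2Space.of_injective_continuous (f := fun f : F => (f : Ω → 𝕜)) Subtype.val_injective
    continuous_induced_dom

/-- Bounded absolutely convex closed sets are compact for the topology of pointwise convergence if
the mixed topology is semi-reflexive. -/
theorem isCompact_pointwise_of_semiReflexive {γ : TopologicalSpace F} (hγ : IsLCH 𝕜 γ)
    (hle : γ ≤ pointwiseTopology F) (hs : SemiReflexive 𝕜 γ) {C : Set F} (hC : AbsConvex 𝕜 C)
    (hne : C.Nonempty) (hb : IsBdd 𝕜 γ C) (hcl : IsClosed[γ] C) :
    @IsCompact F (pointwiseTopology F) C := by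
  let := γ
  have := hγ.polynormable
  have hb' : IsVonNBounded 𝕜 C := hb
  let δ : Ω → StrongDual 𝕜 F := fun x => ⟨pointEval F x, continuous_le_dom hle (continuous_pointEval F x)⟩
  refine isCompact_pointwise_of_linear F (Z := StrongDual 𝕜 F) (dualSeminorm C) δ ?_ ?_
  · intro f hf
    exact ⟨{ toFun := fun ℓ => ℓ f, map_add' := fun _ _ => rfl, map_smul' := fun _ _ => rfl },
      fun ℓ => norm_le_dualSeminorm hb' ℓ hf, fun x => rfl⟩
  · intro L hL
    -- The supremum over the bounded set `C` is a continuous seminorm on the strong dual, so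
    -- semi-reflexivity applies to `L`.
    have hLc : Continuous L := by
      refine continuous_of_continuousAt_zero L ?_
      rw [ContinuousAt, map_zero]
      refine Metric.nhds_basis_ball.tendsto_right_iff.2 fun ε hε => ?_
      filter_upwards [dualSeminorm_ball_mem_nhds hb' hε] with ℓ hℓ
      rw [Seminorm.mem_ball_zero] at hℓ
      rw [mem_ball_zero_iff]
      exact (hL ℓ).trans_lt hℓ
    obtain ⟨f, hf⟩ := hs ⟨L, hLc⟩
    refine ⟨f, ?_, fun x => hf (δ x)⟩
    -- Bipolar argument: a functional separating `f` from `C` would violate the domination of `L`.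
    by_contra hfC
    obtain ⟨ℓ, h1, h2⟩ := PolynormableSpace.exists_separating hC hne hcl hfC
    have h3 := hL ℓ
    have h4 : L ℓ = ℓ f := hf ℓ
    rw [h4] at h3
    linarith [dualSeminorm_le hb' ℓ zero_le_one h1]

/-- The unit ball of a strong dual of a normed space is compact for pointwise convergence. -/
theorem AdmitsStrongBanachLinearisation.exists_isCompact
    (h : AdmitsStrongBanachLinearisation F τ) :
    ∃ p : Seminorm 𝕜 F, IsNormInducing τ p ∧
      @IsCompact F (pointwiseTopology F) (p.closedBall 0 1) := by
  obtain ⟨Y, _, _, σ, -, ⟨q, hq, -⟩, δ, T, ⟨hT1, hT2⟩, hTδ⟩ := h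
  have hD := isNormInducing_dualSeminorm hq.eq_zero fun C => hq.isBdd_iff
  have hB := hq.isBdd_closedBall 1
  -- The dual norm transported by `T`.
  let p : Seminorm 𝕜 F := (dualSeminorm (q.closedBall 0 1)).comp (T : F →ₗ[𝕜] StrongDual 𝕜 Y)
  have hp : IsNormInducing τ p := by
    let := τ
    let e : F ≃ₜ StrongDual 𝕜 Y := ⟨T.toEquiv, hT1, hT2⟩
    have hi : IsInducing (T : F →ₗ[𝕜] StrongDual 𝕜 Y) := e.isInducing
    exact ⟨fun f hf => T.map_eq_zero_iff.1 (hD.eq_zero _ hf), hi.withSeminorms hD.induces⟩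
  have hval : ∀ f x, T f (δ x) = (f : Ω → 𝕜) x := fun f x => congrFun (hTδ f) x
  refine ⟨p, hp, isCompact_pointwise_of_linear F q δ ?_ ?_⟩
  · intro f hf
    refine ⟨(T f : Y →ₗ[𝕜] 𝕜), fun z => ?_, hval f⟩
    rw [Seminorm.mem_closedBall_zero] at hf
    exact (norm_le_dualSeminorm_mul hq.eq_zero hB (T f) z).trans
      (mul_le_of_le_one_left (apply_nonneg q z) hf)
  · intro L hL
    have hLc : Continuous L := hq.continuous_functional L (M := 1) (by simpa using hL)
    obtain ⟨f, hf⟩ := T.surjective ⟨L, hLc⟩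
    refine ⟨f, ?_, fun x => ?_⟩
    · rw [Seminorm.mem_closedBall_zero]
      change dualSeminorm (q.closedBall 0 1) (T f) ≤ 1
      refine dualSeminorm_le hB _ zero_le_one fun z hz => ?_
      rw [hf]
      exact (hL z).trans (by simpa using hz)
    · rw [← hval, hf]
      rfl

/-- The strong dual of the prebidual is the Banach predual, with `δ x` the element representing
evaluation at `x`. -/
theorem HasSemiMontelPrebidualWithEvaluations.admitsStrongBanachLinearisation
    (h : HasSemiMontelPrebidualWithEvaluations F τ) : AdmitsStrongBanachLinearisation F τ := by
  obtain ⟨Y, _, _, σ, -, -, hD, φ, hφ, hex⟩ := h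
  choose y hy using fun x => (hex x).exists
  obtain ⟨q, hq, hqc⟩ := hD
  exact ⟨StrongDual 𝕜 Y, ContinuousLinearMap.addCommGroup, ContinuousLinearMap.module,
    ContinuousLinearMap.topologicalSpace, hq.isLCH, ⟨q, hq, hqc⟩, y, φ,
    hφ, fun f => funext fun x => (hy x f).symm⟩

theorem BBC.exists_isCompact {τ' : TopologicalSpace F} (hle : τ' ≤ pointwiseTopology F)
    {p : Seminorm 𝕜 F} (hp : IsNormInducing τ p) (h : BBC 𝕜 τ τ') :
    ∃ p : Seminorm 𝕜 F, IsNormInducing τ p ∧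
      @IsCompact F (pointwiseTopology F) (p.closedBall 0 1) := by
  obtain ⟨C, hsub, hC, hb, hcomp⟩ := h _ (hp.isBdd_closedBall 1)
  exact hp.exists_isCompact (isLCH_pointwiseTopology F) hC hb hsub (isCompact_of_le hle hcomp)

theorem BBCl.exists_isCompact_of_semiReflexive {τ' : TopologicalSpace F} {p : Seminorm 𝕜 F}
    (h : BBCl 𝕜 τ τ') (hp : IsNormInducing τ p) (hτ' : IsLCH 𝕜 τ')
    (hle : τ' ≤ pointwiseTopology F) (hle' : τ ≤ τ')
    (hs : SemiReflexive 𝕜 (mixedTopology 𝕜 τ τ')) :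
    ∃ p : Seminorm 𝕜 F, IsNormInducing τ p ∧
      @IsCompact F (pointwiseTopology F) (p.closedBall 0 1) := by
  obtain ⟨C, hsub, hC, hb, hcl⟩ := h _ (hp.isBdd_closedBall 1)
  have hB := exists_isMixedBasis hp hτ' hC hb hcl hsub
  have hγ := mixedTopology_le hp.isLCH hτ' hB
  exact hp.exists_isCompact (isLCH_pointwiseTopology F) hC hb hsub
    (isCompact_pointwise_of_semiReflexive F (isLCH_mixedTopology hp.isLCH hτ' hB) (hγ.trans hle) hs
      hC ⟨0, hsub (by simp)⟩ (isBdd_mixedTopology hp hτ' hle' hB hb) (hcl.mono hγ))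

theorem isCompact_pointwise_of_memBddDual {τ' : TopologicalSpace F}
    (h : ∀ x, MemBddDual 𝕜 τ τ' (pointEval F x)) {C : Set F} (hb : IsBdd 𝕜 τ C)
    (hC : @IsCompact F τ' C) : @IsCompact F (pointwiseTopology F) C := by
  rw [isCompact_pointwise_iff]
  let := τ'
  exact hC.image_of_continuousOn (continuousOn_pi.2 fun x => h x C hb)

section Compact

variable {p : Seminorm 𝕜 F}

/-- Point evaluations are bounded on the compact unit ball, hence continuous for the norm. -/
theorem le_pointwiseTopology (hp : IsNormInducing τ p)
    (hK : @IsCompact F (pointwiseTopology F) (p.closedBall 0 1)) : τ ≤ pointwiseTopology F := by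
  refine continuous_iff_le_induced.1 (@continuous_pi F Ω _ τ _ _ fun x => ?_)
  obtain ⟨M, hM⟩ := isBounded_iff_forall_norm_le.1
    (@IsCompact.image F 𝕜 (pointwiseTopology F) _ _ _ hK (continuous_pointEval F x)).isBounded
  refine hp.continuous_functional (pointEval F x) (M := M) fun f => ?_
  exact Seminorm.le_mul_of_closedBall hp.eq_zero
    (q := (normSeminorm 𝕜 𝕜).comp (pointEval F x))
    (fun f hf => hM _ (Set.mem_image_of_mem _ hf)) f

theorem sameBounded_of_isCompact (hp : IsNormInducing τ p)
    (hK : @IsCompact F (pointwiseTopology F) (p.closedBall 0 1)) :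
    SameBounded 𝕜 τ (mixedTopology 𝕜 τ (pointwiseTopology F)) :=
  sameBounded_mixedTopology hp (isLCH_pointwiseTopology F) (le_pointwiseTopology F hp hK)
    ((isLCH_pointwiseTopology F).isClosed_closedBall hK one_pos)

theorem semiReflexive_of_isCompact (hp : IsNormInducing τ p)
    (hK : @IsCompact F (pointwiseTopology F) (p.closedBall 0 1)) :
    SemiReflexive 𝕜 (mixedTopology 𝕜 τ (pointwiseTopology F)) := by
  have hlch := isLCH_pointwiseTopology F
  have hB := exists_isMixedBasis_of_isClosed hp hlch (hlch.isClosed_closedBall hK one_pos)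
  obtain ⟨φ, -, hφ⟩ := exists_isTopIso_bidual hp (isLCH_mixedTopology hp.isLCH hlch hB)
    (sameBounded_of_isCompact F hp hK)
    (isCompact_mixedTopology hp hlch hB (hp.isBdd_closedBall 1) hK)
  intro ψ
  obtain ⟨f, rfl⟩ := φ.surjective ψ
  exact ⟨f, hφ f⟩

theorem hasSemiMontelPrebidual_of_isCompact (hp : IsNormInducing τ p)
    (hK : @IsCompact F (pointwiseTopology F) (p.closedBall 0 1)) :
    HasSemiMontelPrebidualWithEvaluations F τ := by
  have hlch := isLCH_pointwiseTopology F
  have hB := exists_isMixedBasis_of_isClosed hp hlch (hlch.isClosed_closedBall hK one_pos)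
  have hγ := isLCH_mixedTopology hp.isLCH hlch hB
  have hb := sameBounded_of_isCompact F hp hK
  have hKγ := isCompact_mixedTopology hp hlch hB (hp.isBdd_closedBall 1) hK
  obtain ⟨φ, hφ, hφe⟩ := exists_isTopIso_bidual hp hγ hb hKγ
  refine ⟨F, inferInstance, inferInstance, mixedTopology 𝕜 τ (pointwiseTopology F), hγ,
    semiMontel_of_isCompact hp hγ hb hKγ, ?_, φ, hφ, fun x => ?_⟩
  · exact @completelyNormable_strongDual 𝕜 _ F _ _ (mixedTopology 𝕜 τ (pointwiseTopology F)) p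
      hp.eq_zero (fun C => (hb C).symm.trans hp.isBdd_iff)
      fun ℓ hℓ => continuous_mixedTopology_of_continuousOn hp hlch hB ℓ hℓ
  · have hc := continuous_le_dom (mixedTopology_le hp.isLCH hlch hB) (continuous_pointEval F x)
    let := mixedTopology 𝕜 τ (pointwiseTopology F)
    let y : StrongDual 𝕜 F := ⟨pointEval F x, hc⟩
    -- Uniqueness holds because `φ` is the evaluation map, so a representing functional is
    -- determined by its values on `F`.
    exact ⟨y, fun f => (hφe f y).symm,
      fun y hy => ContinuousLinearMap.ext fun f => (hφe f y).symm.trans (hy f).symm⟩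

end Compact

end FunctionSpace

end Linearisation

/-- Condition (i) is the hub: each implication out of it uses the pointwise topology as `τ'`. -/
theorem mainTheorem6 {𝕜 : Type*} [RCLike 𝕜] {Ω : Type*} [Nonempty Ω]
    (F : Submodule 𝕜 (Ω → 𝕜)) (τ : TopologicalSpace F)
    (hτ : Linearisation.IsLCH 𝕜 τ) (hborn : Linearisation.IsBornologicalSpace 𝕜 τ) :
    [ -- (a)
      Linearisation.AdmitsStrongBanachLinearisation F τ,
      -- (b)
      Linearisation.HasSemiMontelPrebidualWithEvaluations F τ,
      -- (c)
      Linearisation.CompletelyNormable 𝕜 τ ∧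
        ∃ τ' : TopologicalSpace F, Linearisation.IsLCH 𝕜 τ' ∧
          τ' ≤ Linearisation.pointwiseTopology F ∧
          Linearisation.BBC 𝕜 τ τ' ∧ Linearisation.CNC 𝕜 τ τ' ∧
          Linearisation.SameBounded 𝕜 τ (Linearisation.mixedTopology 𝕜 τ τ'),
      -- (d)
      Linearisation.CompletelyNormable 𝕜 τ ∧
        ∃ τ' : TopologicalSpace F, Linearisation.IsLCH 𝕜 τ' ∧
          τ' ≤ Linearisation.pointwiseTopology F ∧ τ ≤ τ' ∧
          Linearisation.BBCl 𝕜 τ τ' ∧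
          Linearisation.SemiReflexive 𝕜 (Linearisation.mixedTopology 𝕜 τ τ'),
      -- (e)
      Linearisation.CompletelyNormable 𝕜 τ ∧
        ∃ τ' : TopologicalSpace F, Linearisation.IsLCH 𝕜 τ' ∧
          τ' ≤ Linearisation.pointwiseTopology F ∧ Linearisation.BBC 𝕜 τ τ',
      -- (f)
      ∃ p : Seminorm 𝕜 F, Linearisation.IsNormInducing τ p ∧
        ∃ τ' : TopologicalSpace F, Linearisation.IsLCH 𝕜 τ' ∧
          τ' ≤ Linearisation.pointwiseTopology F ∧ @IsCompact F τ' (p.closedBall 0 1),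
      -- (g)
      ∃ p : Seminorm 𝕜 F, Linearisation.IsNormInducing τ p ∧
        ∃ τ' : TopologicalSpace F, Linearisation.IsLCH 𝕜 τ' ∧
          (∀ x : Ω, Linearisation.MemBddDual 𝕜 τ τ' (Linearisation.pointEval F x)) ∧
          @IsCompact F τ' (p.closedBall 0 1),
      -- (h)
      Linearisation.CompletelyNormable 𝕜 τ ∧
        Linearisation.BBC 𝕜 τ (Linearisation.pointwiseTopology F),
      -- (i)
      ∃ p : Seminorm 𝕜 F, Linearisation.IsNormInducing τ p ∧
        @IsCompact F (Linearisation.pointwiseTopology F) (p.closedBall 0 1) ].TFAE := by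
  have hlch := Linearisation.isLCH_pointwiseTopology F
  tfae_have 1 → 9 := fun h => h.exists_isCompact
  tfae_have 9 → 2 := fun ⟨p, hp, hK⟩ => Linearisation.hasSemiMontelPrebidual_of_isCompact F hp hK
  tfae_have 2 → 1 := fun h => h.admitsStrongBanachLinearisation
  tfae_have 9 → 3 := fun ⟨p, hp, hK⟩ =>
    ⟨Linearisation.completelyNormable_of_isCompact hp hlch hK, _, hlch, le_rfl,
      Linearisation.bbc_of_isCompact hp hlch hK, Linearisation.cnc_of_isCompact hp hlch hK,
      Linearisation.sameBounded_of_isCompact F hp hK⟩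
  tfae_have 3 → 5 := fun ⟨h, τ', h1, h2, h3, _⟩ => ⟨h, τ', h1, h2, h3⟩
  tfae_have 5 → 9 := fun ⟨⟨_, hp, _⟩, _, _, h2, h3⟩ => h3.exists_isCompact F h2 hp
  tfae_have 9 → 4 := fun ⟨p, hp, hK⟩ =>
    ⟨Linearisation.completelyNormable_of_isCompact hp hlch hK, _, hlch, le_rfl,
      Linearisation.le_pointwiseTopology F hp hK,
      (Linearisation.bbc_of_isCompact hp hlch hK).bbcl hlch,
      Linearisation.semiReflexive_of_isCompact F hp hK⟩
  tfae_have 4 → 9 := fun ⟨⟨_, hp, _⟩, _, h1, h2, h3, h4, h5⟩ =>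
    h4.exists_isCompact_of_semiReflexive F hp h1 h2 h3 h5
  tfae_have 9 → 8 := fun ⟨p, hp, hK⟩ =>
    ⟨Linearisation.completelyNormable_of_isCompact hp hlch hK,
      Linearisation.bbc_of_isCompact hp hlch hK⟩
  tfae_have 8 → 5 := fun ⟨h, h1⟩ => ⟨h, _, hlch, le_rfl, h1⟩
  tfae_have 9 → 6 := fun ⟨p, hp, hK⟩ => ⟨p, hp, _, hlch, le_rfl, hK⟩
  tfae_have 6 → 7 := fun ⟨p, hp, τ', h1, h2, hK⟩ => ⟨p, hp, τ', h1, fun x _ _ =>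
    (continuous_le_dom h2 (Linearisation.continuous_pointEval F x)).continuousOn, hK⟩
  tfae_have 7 → 9 := fun ⟨p, hp, τ', _, h2, hK⟩ => ⟨p, hp,
    Linearisation.isCompact_pointwise_of_memBddDual F h2 (hp.isBdd_closedBall 1) hK⟩
  tfae_finish
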